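/- **Lemma (Optimality of parallel storage).** Let $G$ be a compact group with normalized Haar measure $dg$ and let $g\mapsto U_g$ be a continuous unitary representation of $G$ on $\mathbb C^d$, $d\ge 1$. Let $N\ge 0$. Let $\mathcal H_i=\bigotimes_{n=0}^{N-1}\mathcal H_{2n+1}$ and $\mathcal H_o=\bigotimes_{n=0}^{N-1}\mathcal H_{2n+2}$ (all factors $\mathbb C^d$) be the spaces of the inputs and outputs of $N$ uses of $U_g$, and write $|A\rangle\!\rangle=\sum_{m,n}\langle m|A|n\rangle\,|m\rangle|n\rangle$. For $C$ on $\mathcal K\otimes\mathcal H$ and $\rho$ on $\mathcal H$ let $C*\rho=\mathrm{Tr}_{\mathcal H}[C(I\otimes\rho^T)]$; $C$ is the Choi operator of a channel from $\mathcal H$ to $\mathcal K$ if $C\ge0$ and $\mathrm{Tr}_{\mathcal K}C=I$, and then $C*\rho$ is the output of the channel on $\rho$. Call an operator $\Gamma$ on $\mathcal H_o\otimes\mathcal H_i$ *normalized* if there are operators $\Gamma_n$ on $\mathcal H_1\otimes\dots\otimes\mathcal H_{2n}$ ($0\le n\le N$) and $A_n\ge0$ on $\mathcal H_1\otimes\dots\otimes\mathcal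 H_{2n+1}$ ($0\le n<N$) with $\Gamma_0=1$, $\Gamma_N=\Gamma$, $\mathrm{Tr}_{2n+1}A_n=\Gamma_n$ and $\Gamma_{n+1}=I_{2n+2}\otimes A_n$. A *storing board* with memory $\mathcal H_M=\mathbb C^m$ is a quantum comb $S\ge 0$ on $\mathcal H_M\otimes\mathcal H_o\otimes\mathcal H_i$ with $\mathrm{Tr}_M S$ normalized; after the uses of $U_g$ are inserted the memory is in the state $\rho_g=S*|U_g\rangle\!\rangle\langle\!\langle U_g|^{\otimes N}$. A *retrieving channel* with memory $\mathcal H_M$ is (the Choi operator $R$ of) a channel from $\mathcal H_{2N+2}\otimes\mathcal H_M$ to $\mathcal H_{2N+3}$, where $\mathcal H_{2N+2}\simeq\mathcal H_{2N+3}\simeq\mathbb C^d$; a memory state $\rho_g$ then gives the channel on $\mathbb C^d$ with Choi operator $C_g=R*\rho_g$. A *learning comb* is an operator $L\ge0$ on $\mathcal H_{2N+3}\otimes\mathcal H_{2N+2}\otimes\mathcal H_o\otimes\mathcal H_i$ with $\mathrm{Tr}_{2N+3}L=I_{2N+2}\otimes\Gamma$ for some normalized $\Gamma\ge0$; it gives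 $C_g=L*|U_g\rangle\!\rangle\langle\!\langle U_g|^{\otimes N}$. The average fidelity of $(C_g)$ is $F=\frac1{d^2}\int_G\langle\!\langle U_g|C_g|U_g\rangle\!\rangle\,dg$. For a unit vector $|\varphi\rangle\in\mathcal H_o\otimes\mathcal H_i$ let $|\varphi_g\rangle=(U_g^{\otimes N}\otimes I^{\otimes N})|\varphi\rangle$ be the memory state (on $\mathcal H_o\otimes\mathcal H_i$) produced by parallel storage. 1. Let $S$ be a storing board, with any memory, such that $[\mathrm{Tr}_MS,\ U_g^{*\otimes N}\otimes U_h^{\otimes N}]=0$ on $\mathcal H_o\otimes\mathcal H_i$ for all $g,h\in G$. Then there are a unit vector $|\varphi\rangle\in\mathcal H_o\otimes\mathcal H_i$ and a channel $\mathcal D$ from $\mathcal H_o\otimes\mathcal H_i$ to $\mathcal H_M$ with $\rho_g=\mathcal D(|\varphi_g\rangle\langle\varphi_g|)$ for all $g\in G$. If $S$ has the form $|\Psi\rangle\langle\Psi|$, there is also, for the same $|\varphi\rangle$, a channel $\mathcal E$ from $\mathcal H_M$ to $\mathcal H_o\otimes\mathcal H_i$ with $|\varphi_g\rangle\langle\varphi_g|=\mathcal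 E(\rho_g)$ for all $g\in G$. 2. For every storing board $S$, with any memory, there is a unit vector $|\varphi\rangle\in\mathcal H_o\otimes\mathcal H_i$ such that for every retrieving channel $R$ there is a retrieving channel $R'$ with memory $\mathcal H_o\otimes\mathcal H_i$ for which the parallel storage $|\varphi_g\rangle$ followed by $R'$ has the same average fidelity as $S$ followed by $R$. 3. There are a unit vector $|\varphi\rangle\in\mathcal H_o\otimes\mathcal H_i$ and a retrieving channel $R'$ with memory $\mathcal H_o\otimes\mathcal H_i$ such that the average fidelity of the parallel storage $|\varphi_g\rangle$ followed by $R'$ is the maximum of the average fidelity over all storing boards (with memories of arbitrary finite dimension) followed by retrieving channels, and is also the maximum over all learning combs. -/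

import Mathlib

open scoped Kronecker ComplexOrder
open MeasureTheory

/-- Multi-indices `x = (x_1, …, x_N)` of the standard basis of `(ℂ^d)^{⊗N}`. -/
abbrev MIdx (N d : ℕ) : Type := Fin N → Fin d

/-- Basis indices of `H_o ⊗ H_i`: the first component refers to the `N` output systems of the
examples, the second one to the `N` input systems of the examples. -/
abbrev OIIdx (N d : ℕ) : Type := MIdx N d × MIdx N d

/-- Partial trace over the left factor of a tensor product. -/
def trLeft {α β : Type} [Fintype α] (A : Matrix (α × β) (α × β) ℂ) : Matrix β β ℂ :=
  fun b b' => ∑ a, A (a, b) (a, b')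

/-- Partial trace over the right factor of a tensor product. -/
def trRight {α β : Type} [Fintype β] (A : Matrix (α × β) (α × β) ℂ) : Matrix α α ℂ :=
  fun a a' => ∑ b, A (a, b) (a', b)

/-- The link product `C * ρ = Tr_H [C (I_K ⊗ ρᵀ)]` of an operator `C` on `K ⊗ H` with an operator
`ρ` on `H`. If `C` is the Choi operator of a channel from `H` to `K`, this is the output of the
channel on `ρ`. -/
def link {α β : Type} [Fintype α] [Fintype β] [DecidableEq α]
    (C : Matrix (α × β) (α × β) ℂ) (ρ : Matrix β β ℂ) : Matrix α α ℂ :=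
  trRight (C * ((1 : Matrix α α ℂ) ⊗ₖ ρ.transpose))

/-- The (unnormalized) projector `|v⟩⟨v|`. -/
def proj {α : Type} (v : α → ℂ) : Matrix α α ℂ := Matrix.vecMulVec v (star v)

/-- The vector `|A⟩⟩ = ∑ ⟨m|A|n⟩ |m⟩|n⟩` in `K ⊗ H` of an operator `A` from `H` to `K`. -/
def dket {α β : Type} (A : Matrix α β ℂ) : α × β → ℂ := fun p => A p.1 p.2

/-- The `N`-fold tensor power `A^{⊗N}`. -/
def tpow (N : ℕ) {d : ℕ} (A : Matrix (Fin d) (Fin d) ℂ) : Matrix (MIdx N d) (MIdx N d) ℂ :=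
  fun x y => ∏ k, A (x k) (y k)

/-- `C`, on (output) `⊗` (input), is the Choi operator of a quantum channel: `C ≥ 0` and the
partial trace over the output is the identity of the input. -/
def IsChannel {α β : Type} [Fintype α] [Fintype β] [DecidableEq β]
    (C : Matrix (α × β) (α × β) ℂ) : Prop :=
  C.PosSemidef ∧ trLeft C = 1

/-- The recursive normalization of quantum combs. The systems are `H_1, …, H_{2n}`; the odd ones
are the inputs of the examples and the even ones their outputs. For `n = 0` the operator is `1`.
The operator `Γ` on `H_1, …, H_{2n+2}` satisfies the condition if
`Γ = I_{2n+2} ⊗ A` with `A ≥ 0` on `H_1, …, H_{2n+1}`, where `Tr_{2n+1} A = Γ'`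
and `Γ'` on `H_1, …, H_{2n}` satisfies the condition again. -/
def IsNormalized (d : ℕ) : (n : ℕ) → Matrix (OIIdx n d) (OIIdx n d) ℂ → Prop
  | 0, Γ => Γ = 1
  | n + 1, Γ =>
    ∃ A : Matrix (MIdx n d × MIdx (n + 1) d) (MIdx n d × MIdx (n + 1) d) ℂ,
    ∃ Γ' : Matrix (OIIdx n d) (OIIdx n d) ℂ,
      A.PosSemidef ∧
      (∀ (o o' : MIdx (n + 1) d) (i i' : MIdx (n + 1) d),
        Γ (o, i) (o', i') =
          if o (Fin.last n) = o' (Fin.last n) then A (Fin.init o, i) (Fin.init o', i') else 0) ∧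
      (∀ (o o' i i' : MIdx n d),
        ∑ x : Fin d, A (o, Fin.snoc (α := fun _ => Fin d) i x)
          (o', Fin.snoc (α := fun _ => Fin d) i' x) = Γ' (o, i) (o', i')) ∧
      IsNormalized d n Γ'

/-- The comb `S ≥ 0` of a storing board with `N` open slots and a final output system of
dimension `m`, the quantum memory. `S` acts on `M ⊗ (H_o ⊗ H_i)`. -/
def IsStoringComb (N d m : ℕ)
    (S : Matrix (Fin m × OIIdx N d) (Fin m × OIIdx N d) ℂ) : Prop :=
  S.PosSemidef ∧ IsNormalized d N (trLeft S)

/-- The comb `L ≥ 0` of a whole learning process. `L` acts on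
`(H_{2N+3} ⊗ H_{2N+2}) ⊗ (H_o ⊗ H_i)` and `Tr_{2N+3} L = I_{2N+2} ⊗ Γ` with `Γ ≥ 0`
satisfying the recursive normalization. -/
def IsLearningComb (N d : ℕ)
    (L : Matrix ((Fin d × Fin d) × OIIdx N d) ((Fin d × Fin d) × OIIdx N d) ℂ) : Prop :=
  L.PosSemidef ∧ ∃ Γ : Matrix (OIIdx N d) (OIIdx N d) ℂ, Γ.PosSemidef ∧
    trLeft (L.submatrix (Equiv.prodAssoc _ _ _).symm (Equiv.prodAssoc _ _ _).symm) =
      (1 : Matrix (Fin d) (Fin d) ℂ) ⊗ₖ Γ ∧ IsNormalized d N Γ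

/-- The Choi operator `R`, on `(H_{2N+3} ⊗ H_{2N+2}) ⊗ M`, of a retrieving channel
from `H_{2N+2} ⊗ M` to `H_{2N+3}`. -/
def IsRetrieving (d : ℕ) {M : Type} [Fintype M] [DecidableEq M]
    (R : Matrix ((Fin d × Fin d) × M) ((Fin d × Fin d) × M) ℂ) : Prop :=
  IsChannel (R.submatrix (Equiv.prodAssoc _ _ _).symm (Equiv.prodAssoc _ _ _).symm)

/-- `|U⟩⟩⟨⟨U|^{⊗N}` on `H_o ⊗ H_i`, the Choi operator of the `N` examples of `U`. -/
def examples (N : ℕ) {d : ℕ} (U : Matrix (Fin d) (Fin d) ℂ) :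
    Matrix (OIIdx N d) (OIIdx N d) ℂ :=
  proj (dket (tpow N U))

/-- The state `|φ_U⟩ = (U^{⊗N} ⊗ I^{⊗N}) |φ⟩` of `H_o ⊗ H_i` obtained by applying the `N` examples
of `U` in parallel. -/
def parallelState (N : ℕ) {d : ℕ} (U : Matrix (Fin d) (Fin d) ℂ) (φ : OIIdx N d → ℂ) :
    OIIdx N d → ℂ :=
  (tpow N U ⊗ₖ (1 : Matrix (MIdx N d) (MIdx N d) ℂ)).mulVec φ

/-- The average over `g`, with respect to `μ`, of the channel fidelity
`⟨⟨U_g| C_g |U_g⟩⟩ / d²` between the channel with Choi operator `C_g` and `U_g`. -/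
noncomputable def avgFidelity {G : Type*} [MeasurableSpace G] (μ : Measure G) {d : ℕ}
    (u : G → Matrix (Fin d) (Fin d) ℂ)
    (C : G → Matrix (Fin d × Fin d) (Fin d × Fin d) ℂ) : ℝ :=
  (∫ g, (star (dket (u g)) ⬝ᵥ (C g).mulVec (dket (u g))).re ∂μ) / (d : ℝ) ^ 2

/-! Let Γ = Tr_M S and let R be its positive square root. Factoring S through its marginal gives S =
(I ⊗ R) D (I ⊗ R) with D a channel (`exists_channel_factor`). Moving the roots through the link
product gives ρ_g = D(Rᵀ |U_g⟩⟩⟨⟨U_g|^{⊗N} Rᵀ). If Γ commutes with U_g^{*⊗N} ⊗ I, so does R; hence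
Rᵀ commutes with U_g^{⊗N} ⊗ I, and Rᵀ |U_g⟩⟩^{⊗N} = (U_g^{⊗N} ⊗ I) Rᵀ|I⟩⟩ (`sqrt_examples`). This is
parallel storage of φ = Rᵀ|I⟩⟩, a unit vector because normalization forces ⟨⟨I|Γᵀ|I⟩⟩ = 1
(`IsNormalized.sum_diagonal`). If S is pure, D can be undone on these states by a polar
decomposition (`exists_polar_channel`).

A general board is not covariant, but board and retrieval together form a learning comb L, and the
fidelity for g is a quadratic form of L at a vector f_g that the group translates. Invariance of
Haar measure therefore allows L to be averaged over the group at no cost (`avgFidelity_twirl`). The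
averaged comb has the averaged Γ as its marginal: still normalized (`isNormalized_twirl`), now
covariant, and independent of the retrieving channel. Factoring the averaged comb through the root
of that marginal gives parallel storage followed by a retrieving channel
(`exists_parallel_of_learning`).

The learning combs form a compact set on which the average fidelity is continuous. A maximizer
exists, and its parallel replacement attains both maxima. -/

/-- `R` is a Hermitian square root of `Γ`, with Hermitian pseudo-inverse `Q`. -/
structure SqrtPair {β : Type} [Fintype β] (Γ R Q : Matrix β β ℂ) : Prop where
  herm : R.IsHermitian
  herm_inv : Q.IsHermitian
  sq : R * R = Γ
  comm : Q * R = R * Q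
  left : R * Q * R = R
  right : Q * R * Q = Q

/-- Both operators are functions of Γ. The spectrum is finite, so continuity is automatic, and the
convention `0⁻¹ = 0` turns the pointwise inverse into a pseudo-inverse. Whatever commutes with Γ
commutes with its functions; this carries covariance from Γ to its root. -/
theorem exists_sqrtPair {β : Type} [Fintype β] [DecidableEq β] {Γ : Matrix β β ℂ}
    (h : Γ.PosSemidef) : ∃ R Q, SqrtPair Γ R Q ∧ ∀ W, Commute Γ W → Commute R W := by
  have hc : ∀ f : ℝ → ℝ, ContinuousOn f (spectrum ℝ Γ) := fun f =>
    (Matrix.finite_real_spectrum (A := Γ)).continuousOn f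
  have hsa : IsSelfAdjoint Γ := h.isHermitian
  have hm : ∀ f g : ℝ → ℝ, cfc f Γ * cfc g Γ = cfc (fun x => f x * g x) Γ := fun f g =>
    (cfc_mul f g Γ (hc f) (hc g)).symm
  refine ⟨cfc Real.sqrt Γ, cfc (fun x => (Real.sqrt x)⁻¹) Γ, ⟨?_, ?_, ?_, ?_, ?_, ?_⟩, ?_⟩
  · exact cfc_predicate (R := ℝ) (p := IsSelfAdjoint) _ Γ
  · exact cfc_predicate (R := ℝ) (p := IsSelfAdjoint) _ Γ
  · rw [hm]
    conv_rhs => rw [← cfc_id ℝ Γ hsa]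
    refine cfc_congr fun x hx => ?_
    have h0 := (Matrix.posSemidef_iff_isHermitian_and_spectrum_nonneg.1 h).2 hx
    exact Real.mul_self_sqrt (Complex.zero_le_real.1 h0)
  · rw [hm, hm]
    simp only [mul_comm]
  · rw [hm, hm]
    exact cfc_congr fun x _ => mul_inv_mul_cancel _
  · rw [hm, hm]
    refine cfc_congr fun x _ => ?_
    simpa using mul_inv_mul_cancel (Real.sqrt x)⁻¹
  · exact fun W hW => hW.cfc_real _

/-! ### Partial traces, link products and factorization through a marginal -/

section partialTrace

variable {α β : Type}

variable [Fintype α] [Fintype β]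

theorem one_kronecker_mul_apply [DecidableEq α] {γ : Type} (K : Matrix γ β ℂ) {ι : Type}
    (X : Matrix (α × β) ι ℂ) (a : α) (c : γ) (i : ι) :
    (((1 : Matrix α α ℂ) ⊗ₖ K) * X) (a, c) i = ∑ b, K c b * X (a, b) i := by
  simp [Matrix.mul_apply, Fintype.sum_prod_type, Matrix.one_apply, ite_mul]

theorem mul_one_kronecker_apply [DecidableEq α] {γ : Type} (K : Matrix β γ ℂ) {ι : Type}
    (X : Matrix ι (α × β) ℂ) (a : α) (c : γ) (i : ι) :
    (X * ((1 : Matrix α α ℂ) ⊗ₖ K)) i (a, c) = ∑ b, X i (a, b) * K b c := by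
  simp [Matrix.mul_apply, Fintype.sum_prod_type, Matrix.one_apply, ite_mul]

theorem trLeft_one_kronecker_mul [DecidableEq α] (K : Matrix β β ℂ)
    (X : Matrix (α × β) (α × β) ℂ) :
    trLeft (((1 : Matrix α α ℂ) ⊗ₖ K) * X) = K * trLeft X := by
  ext b b'
  simp only [trLeft, one_kronecker_mul_apply]
  simp only [Matrix.mul_apply, trLeft, Finset.mul_sum]
  exact Finset.sum_comm

theorem trLeft_mul_one_kronecker [DecidableEq α] (K : Matrix β β ℂ)
    (X : Matrix (α × β) (α × β) ℂ) :
    trLeft (X * ((1 : Matrix α α ℂ) ⊗ₖ K)) = trLeft X * K := by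
  ext b b'
  simp only [trLeft, mul_one_kronecker_apply]
  simp only [Matrix.mul_apply, trLeft, Finset.sum_mul]
  exact Finset.sum_comm

/-- A unitary on the traced factor cancels by cyclicity, while an operator on the other factor
leaves the trace. -/
theorem trLeft_conj_unitary [DecidableEq β] [DecidableEq α] {V : Matrix α α ℂ}
    (hV : V.conjTranspose * V = 1) (K : Matrix β β ℂ) (X : Matrix (α × β) (α × β) ℂ) :
    trLeft ((V ⊗ₖ K) * X * (V ⊗ₖ K).conjTranspose) = K * trLeft X * K.conjTranspose := by
  have h0 : ∀ Y : Matrix (α × β) (α × β) ℂ,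
      trLeft ((V ⊗ₖ (1 : Matrix β β ℂ)) * Y * (V.conjTranspose ⊗ₖ (1 : Matrix β β ℂ))) =
        trLeft Y := by
    intro Y
    ext b b'
    have e : ∀ a a', (V.conjTranspose * V) a a' = ∑ c, star (V c a) * V c a' := fun a a' => by
      simp [Matrix.mul_apply]
    have e1 : ∀ a, ((V ⊗ₖ (1 : Matrix β β ℂ)) * Y *
        (V.conjTranspose ⊗ₖ (1 : Matrix β β ℂ))) (a, b) (a, b') =
        ∑ c', ∑ c, Y (c, b) (c', b') * (star (V a c') * V a c) := by
      intro a
      simp only [Matrix.mul_apply, Fintype.sum_prod_type, Matrix.kroneckerMap_apply,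
        Matrix.one_apply, Matrix.conjTranspose_apply]
      simp only [mul_ite, mul_one, mul_zero, ite_mul, zero_mul, Finset.sum_ite_eq,
        Finset.mem_univ, if_true, Finset.sum_ite_eq', Finset.sum_mul]
      refine Finset.sum_congr rfl fun c' _ => Finset.sum_congr rfl fun c _ => ?_
      ring
    simp only [trLeft, e1]
    rw [Finset.sum_comm]
    have e2 : ∀ c', ∑ a, ∑ c, Y (c, b) (c', b') * (star (V a c') * V a c) = Y (c', b) (c', b') := by
      intro c'
      rw [Finset.sum_comm]
      simp only [← Finset.mul_sum, ← e, hV, Matrix.one_apply]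
      simp
    exact Finset.sum_congr rfl fun c' _ => e2 c'
  have e3 : V ⊗ₖ K = ((1 : Matrix α α ℂ) ⊗ₖ K) * (V ⊗ₖ (1 : Matrix β β ℂ)) := by
    rw [← Matrix.mul_kronecker_mul]; simp
  have e4 : (V ⊗ₖ K).conjTranspose =
      (V.conjTranspose ⊗ₖ (1 : Matrix β β ℂ)) * ((1 : Matrix α α ℂ) ⊗ₖ K.conjTranspose) := by
    rw [← Matrix.mul_kronecker_mul, Matrix.conjTranspose_kronecker]; simp
  rw [e4, e3, ← Matrix.mul_assoc, trLeft_mul_one_kronecker, Matrix.mul_assoc, Matrix.mul_assoc,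
    trLeft_one_kronecker_mul, ← Matrix.mul_assoc (V ⊗ₖ 1), h0]

omit [Fintype β] in
theorem trLeft_kronecker (A : Matrix α α ℂ) (B : Matrix β β ℂ) :
    trLeft (A ⊗ₖ B) = A.trace • B := by
  ext b b'
  simp [trLeft, Matrix.trace, Finset.sum_mul]

omit [Fintype β] in
theorem trLeft_add (X Y : Matrix (α × β) (α × β) ℂ) : trLeft (X + Y) = trLeft X + trLeft Y := by
  ext b b'
  simp [trLeft, Finset.sum_add_distrib]

theorem trace_trLeft (X : Matrix (α × β) (α × β) ℂ) : (trLeft X).trace = X.trace := by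
  simp only [Matrix.trace, trLeft, Matrix.diag_apply, Fintype.sum_prod_type]
  exact Finset.sum_comm

omit [Fintype α] [Fintype β] in
theorem one_kronecker_one_sub [DecidableEq α] [DecidableEq β] (K : Matrix β β ℂ) :
    (1 : Matrix α α ℂ) ⊗ₖ K = 1 - (1 : Matrix α α ℂ) ⊗ₖ (1 - K) := by
  have : (1 : Matrix α α ℂ) ⊗ₖ K + (1 : Matrix α α ℂ) ⊗ₖ (1 - K) = 1 := by
    rw [← Matrix.kronecker_add]; simp
  exact eq_sub_of_add_eq this

theorem Matrix.PosSemidef.eq_zero_of_trace {X : Matrix α α ℂ} (hX : X.PosSemidef)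
    (h : X.trace = 0) : X = 0 := by
  classical
  obtain ⟨B, _, hB, _⟩ := exists_sqrtPair hX
  obtain rfl : B.conjTranspose * B = X := by rw [hB.herm.eq, hB.sq]
  rw [Matrix.trace_conjTranspose_mul_self_eq_zero_iff.1 h]
  simp

omit [Fintype β] in
theorem Matrix.PosSemidef.mul_eq_zero {X : Matrix α α ℂ} (hX : X.PosSemidef)
    {P : Matrix α β ℂ} (h : P.conjTranspose * X * P = 0) : X * P = 0 := by
  classical
  obtain ⟨B, _, hB, _⟩ := exists_sqrtPair hX
  obtain rfl : B.conjTranspose * B = X := by rw [hB.herm.eq, hB.sq]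
  have : (B * P).conjTranspose * (B * P) = 0 := by
    rw [← h, Matrix.conjTranspose_mul]; simp only [Matrix.mul_assoc]
  rw [Matrix.conjTranspose_mul_self_eq_zero] at this
  rw [Matrix.mul_assoc, this, Matrix.mul_zero]

theorem link_apply [DecidableEq α] (C : Matrix (α × β) (α × β) ℂ) (ρ : Matrix β β ℂ)
    (a a' : α) : link C ρ a a' = ∑ b, ∑ b', C (a, b) (a', b') * ρ b b' := by
  simp only [link, trRight, mul_one_kronecker_apply, Matrix.transpose_apply]

omit [Fintype α] in
theorem posSemidef_single [DecidableEq α] (a : α) : (Matrix.single a a (1 : ℂ)).PosSemidef := by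
  have := Matrix.PosSemidef.diagonal (R := ℂ) (d := Pi.single a (1 : ℂ))
    (Pi.single_nonneg.2 zero_le_one)
  rwa [Matrix.diagonal_single] at this

/-- An operator `X ≥ 0` is a channel sandwiched between square roots of its marginal. -/
theorem exists_channel_factor [DecidableEq α] [DecidableEq β] [Nonempty α]
    {X : Matrix (α × β) (α × β) ℂ} (hX : X.PosSemidef) {R Q : Matrix β β ℂ}
    (h : SqrtPair (trLeft X) R Q) :
    ∃ D : Matrix (α × β) (α × β) ℂ, IsChannel D ∧
      X = ((1 : Matrix α α ℂ) ⊗ₖ R) * D * ((1 : Matrix α α ℂ) ⊗ₖ R) := by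
  -- The projection onto the kernel of the marginal.
  set P : Matrix β β ℂ := 1 - R * Q with hP
  have hPh : P.conjTranspose = P := by
    rw [hP, Matrix.conjTranspose_sub, Matrix.conjTranspose_mul, h.herm.eq, h.herm_inv.eq, h.comm]
    simp
  have hPR : P * R = 0 := by rw [hP, Matrix.sub_mul, h.left]; simp
  have hRP : R * P = 0 := by
    rw [hP, Matrix.mul_sub, ← h.comm, ← Matrix.mul_assoc, h.left]; simp
  have hPP : P * P = P := by
    nth_rw 2 [hP]
    rw [Matrix.mul_sub, ← Matrix.mul_assoc, hPR]; simp
  have hPpos : P.PosSemidef := by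
    have := Matrix.posSemidef_conjTranspose_mul_self P
    rwa [hPh, hPP] at this
  -- The compression of `X` by I ⊗ P is positive with trace Tr(P R² P) = 0, so it vanishes; by
  -- positivity `X` itself annihilates the range of I ⊗ P.
  have hXP : X * ((1 : Matrix α α ℂ) ⊗ₖ P) = 0 := by
    apply hX.mul_eq_zero
    apply Matrix.PosSemidef.eq_zero_of_trace
    · exact hX.conjTranspose_mul_mul_same _
    · rw [← trace_trLeft, trLeft_mul_one_kronecker, Matrix.conjTranspose_kronecker, hPh,
        Matrix.conjTranspose_one, trLeft_one_kronecker_mul, ← h.sq, ← Matrix.mul_assoc, hPR]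
      simp
  have hPX : ((1 : Matrix α α ℂ) ⊗ₖ P) * X = 0 := by
    have := congrArg Matrix.conjTranspose hXP
    rwa [Matrix.conjTranspose_mul, Matrix.conjTranspose_kronecker, hPh, hX.isHermitian.eq,
      Matrix.conjTranspose_one, Matrix.conjTranspose_zero] at this
  have hQ1 : ((1 : Matrix α α ℂ) ⊗ₖ Q).conjTranspose = (1 : Matrix α α ℂ) ⊗ₖ Q := by
    rw [Matrix.conjTranspose_kronecker, h.herm_inv.eq, Matrix.conjTranspose_one]
  have hRQ1 : (1 : Matrix α α ℂ) ⊗ₖ R * (1 : Matrix α α ℂ) ⊗ₖ Q = 1 - (1 : Matrix α α ℂ) ⊗ₖ P := by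
    rw [← Matrix.mul_kronecker_mul, Matrix.one_mul, one_kronecker_one_sub]
  have hQR1 : (1 : Matrix α α ℂ) ⊗ₖ Q * (1 : Matrix α α ℂ) ⊗ₖ R = 1 - (1 : Matrix α α ℂ) ⊗ₖ P := by
    rw [← Matrix.mul_kronecker_mul, h.comm, Matrix.one_mul, one_kronecker_one_sub]
  obtain ⟨a₀⟩ := ‹Nonempty α›
  set τ : Matrix α α ℂ := Matrix.single a₀ a₀ 1 with hτ
  have hτpos : τ.PosSemidef := posSemidef_single a₀
  -- The first term has marginal RQ, the support projection. The second prepares the fixed state τ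
  -- on the kernel, which completes the marginal to the identity and disappears when sandwiched
  -- between the roots.
  refine ⟨((1 : Matrix α α ℂ) ⊗ₖ Q) * X * ((1 : Matrix α α ℂ) ⊗ₖ Q) + τ ⊗ₖ P, ⟨?_, ?_⟩, ?_⟩
  · refine Matrix.PosSemidef.add ?_ (hτpos.kronecker hPpos)
    have := hX.conjTranspose_mul_mul_same ((1 : Matrix α α ℂ) ⊗ₖ Q)
    rwa [hQ1] at this
  · rw [trLeft_add, trLeft_mul_one_kronecker, trLeft_one_kronecker_mul, trLeft_kronecker, ← h.sq,
      hτ, Matrix.trace_single_eq_same, one_smul]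
    have : Q * (R * R) * Q = R * Q := by
      rw [← Matrix.mul_assoc, Matrix.mul_assoc, h.comm, ← Matrix.mul_assoc, h.left]
    rw [this, hP]; simp
  · rw [Matrix.mul_add, Matrix.add_mul]
    have e1 : (1 : Matrix α α ℂ) ⊗ₖ R * τ ⊗ₖ P = 0 := by
      rw [← Matrix.mul_kronecker_mul, hRP]; simp
    rw [e1, Matrix.zero_mul, add_zero]
    calc X = (1 - (1 : Matrix α α ℂ) ⊗ₖ P) * X * (1 - (1 : Matrix α α ℂ) ⊗ₖ P) := by
          rw [Matrix.sub_mul, hPX, Matrix.mul_sub]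
          simp [hXP]
      _ = _ := by
          nth_rw 1 [← hRQ1]
          rw [← hQR1]
          simp only [Matrix.mul_assoc]

/-- The partial trace is cyclic for operators on the traced factor; the transposes come from the one
in the link product. -/
theorem link_one_kronecker_conj [DecidableEq α] (R : Matrix β β ℂ)
    (D : Matrix (α × β) (α × β) ℂ) (ρ : Matrix β β ℂ) :
    link (((1 : Matrix α α ℂ) ⊗ₖ R) * D * ((1 : Matrix α α ℂ) ⊗ₖ R)) ρ =
      link D (R.transpose * ρ * R.transpose) := by
  have hcyc : ∀ Y : Matrix (α × β) (α × β) ℂ,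
      trRight (((1 : Matrix α α ℂ) ⊗ₖ R) * Y) = trRight (Y * ((1 : Matrix α α ℂ) ⊗ₖ R)) := by
    intro Y
    ext a a'
    simp only [trRight, one_kronecker_mul_apply, mul_one_kronecker_apply]
    rw [Finset.sum_comm]
    simp only [mul_comm]
  simp only [link]
  rw [Matrix.mul_assoc, Matrix.mul_assoc, hcyc, Matrix.mul_assoc, Matrix.mul_assoc,
    ← Matrix.mul_kronecker_mul, ← Matrix.mul_kronecker_mul]
  simp [Matrix.transpose_mul, Matrix.mul_assoc]

theorem proj_posSemidef (v : α → ℂ) : (proj v).PosSemidef :=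
  Matrix.posSemidef_vecMulVec_self_star v

theorem link_proj_dket [DecidableEq α] (K : Matrix α β ℂ) (ρ : Matrix β β ℂ) :
    link (proj (dket K)) ρ = K * ρ * K.conjTranspose := by
  ext a a'
  simp only [link_apply, proj, dket, Matrix.vecMulVec_apply, Matrix.mul_apply, Finset.sum_mul,
    Matrix.conjTranspose_apply, Pi.star_apply]
  rw [Finset.sum_comm]
  refine Finset.sum_congr rfl fun c' _ => Finset.sum_congr rfl fun c _ => ?_
  ring

omit [Fintype β] in
theorem trLeft_proj_dket (K : Matrix α β ℂ) :
    trLeft (proj (dket K)) = (K.conjTranspose * K).transpose := by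
  ext b b'
  simp [trLeft, proj, dket, Matrix.vecMulVec_apply, Matrix.mul_apply, mul_comm]

omit [Fintype α] in
theorem mul_proj_mul (K : Matrix α β ℂ) (v : β → ℂ) :
    K * proj v * K.conjTranspose = proj (K.mulVec v) := by
  rw [proj, proj, Matrix.mul_vecMulVec, Matrix.vecMulVec_mul, Matrix.star_mulVec]

end partialTrace

/-! ### Entrywise averages of matrix-valued functions -/

section average

variable {G : Type*} [TopologicalSpace G] [CompactSpace G] [MeasurableSpace G] [BorelSpace G]
  (μ : Measure G)

/-- The entrywise integral of a matrix-valued function. -/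
noncomputable def avgM {ι κ : Type} (f : G → Matrix ι κ ℂ) : Matrix ι κ ℂ :=
  Matrix.of fun i j => ∫ g, f g i j ∂μ

variable {μ} {ι κ : Type}

theorem integrable_of_continuous [IsFiniteMeasure μ] {f : G → ℂ} (hf : Continuous f) :
    Integrable f μ :=
  hf.integrable_of_hasCompactSupport (HasCompactSupport.of_compactSpace f)

/-- Expanding in matrix units reduces the claim to a finite sum of scalar integrals. -/
theorem avgM_functional [IsFiniteMeasure μ] [Fintype ι] [Fintype κ] {f : G → Matrix ι κ ℂ}
    (hf : Continuous f) (l : Matrix ι κ ℂ →ₗ[ℂ] ℂ) : l (avgM μ f) = ∫ g, l (f g) ∂μ := by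
  classical
  have key : ∀ X : Matrix ι κ ℂ, l X = ∑ i, ∑ j, X i j * l (Matrix.single i j 1) := by
    intro X
    conv_lhs => rw [Matrix.matrix_eq_sum_single X]
    simp only [map_sum]
    refine Finset.sum_congr rfl fun i _ => Finset.sum_congr rfl fun j _ => ?_
    rw [← smul_eq_mul, ← map_smul, Matrix.smul_single, smul_eq_mul, mul_one]
  have hc : ∀ i j, Integrable (fun g => f g i j * l (Matrix.single i j 1)) μ := fun i j =>
    (integrable_of_continuous (hf.matrix_elem i j)).mul_const _
  simp only [key (f _)]
  rw [key, integral_finsetSum _ fun i _ => integrable_finsetSum _ fun j _ => hc i j]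
  refine Finset.sum_congr rfl fun i _ => ?_
  rw [integral_finsetSum _ fun j _ => hc i j]
  refine Finset.sum_congr rfl fun j _ => ?_
  rw [integral_mul_const]
  rfl

theorem avgM_linear [IsFiniteMeasure μ] [Fintype ι] [Fintype κ] {ι' κ' : Type}
    {f : G → Matrix ι κ ℂ} (hf : Continuous f) (l : Matrix ι κ ℂ →ₗ[ℂ] Matrix ι' κ' ℂ) :
    l (avgM μ f) = avgM μ fun g => l (f g) := by
  ext i j
  exact avgM_functional hf ((Matrix.entryLinearMap ℂ ℂ i j).comp l)

omit [TopologicalSpace G] [CompactSpace G] [BorelSpace G] in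
theorem avgM_const [IsProbabilityMeasure μ] (X : Matrix ι κ ℂ) : avgM μ (fun _ => X) = X := by
  ext i j
  simp [avgM]

theorem posSemidef_avgM [IsFiniteMeasure μ] [Fintype ι] {f : G → Matrix ι ι ℂ} (hf : Continuous f)
    (h : ∀ g, (f g).PosSemidef) : (avgM μ f).PosSemidef := by
  refine Matrix.PosSemidef.of_dotProduct_mulVec_nonneg ?_ fun x => ?_
  · ext i j
    simp only [avgM, Matrix.conjTranspose_apply, Matrix.of_apply]
    rw [← starRingEnd_apply, ← integral_conj]
    simp only [starRingEnd_apply, ← Matrix.conjTranspose_apply, (h _).isHermitian.eq]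
  · let l : Matrix ι ι ℂ →ₗ[ℂ] ℂ :=
      { toFun := fun X => star x ⬝ᵥ X.mulVec x
        map_add' := by intros; simp [Matrix.add_mulVec]
        map_smul' := by intros; simp [Matrix.smul_mulVec] }
    rw [show star x ⬝ᵥ (avgM μ f).mulVec x = l (avgM μ f) from rfl, avgM_functional hf]
    exact integral_nonneg fun g => (h g).dotProduct_mulVec_nonneg x

theorem trLeft_avgM [IsFiniteMeasure μ] [Fintype ι] {f : G → Matrix (ι × κ) (ι × κ) ℂ}
    (hf : Continuous f) : trLeft (avgM μ f) = avgM μ fun g => trLeft (f g) := by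
  ext i j
  exact (integral_finsetSum _ fun a _ => integrable_of_continuous (hf.matrix_elem _ _)).symm

end average

/-! ### Unitary representations and group averages of operators -/

section twirl

variable {G : Type*} [Group G] [TopologicalSpace G] [IsTopologicalGroup G] [CompactSpace G]
  [MeasurableSpace G] [BorelSpace G] {μ : Measure G}

/-- A continuous unitary matrix representation. -/
structure IsUnitaryRep {ι : Type} [Fintype ι] [DecidableEq ι] (V : G → Matrix ι ι ℂ) :
    Prop where
  cont : Continuous V
  unitary : ∀ g, (V g).conjTranspose * V g = 1
  mul : ∀ g h, V (g * h) = V g * V h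

variable (μ) in
/-- The average over the group of the conjugates of an operator. -/
noncomputable def twirl {ι : Type} [Fintype ι] (V : G → Matrix ι ι ℂ) (X : Matrix ι ι ℂ) :
    Matrix ι ι ℂ :=
  avgM μ fun g => V g * X * (V g).conjTranspose

variable {ι κ : Type} [Fintype ι] [DecidableEq ι] [Fintype κ] [DecidableEq κ]
  {V : G → Matrix ι ι ℂ}

namespace IsUnitaryRep

omit [IsTopologicalGroup G] [CompactSpace G] [MeasurableSpace G] [BorelSpace G]

theorem continuous_conj (hV : IsUnitaryRep V) (X : Matrix ι ι ℂ) :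
    Continuous fun g => V g * X * (V g).conjTranspose :=
  (hV.cont.matrix_mul continuous_const).matrix_mul hV.cont.matrix_conjTranspose

theorem mul_conjTranspose (hV : IsUnitaryRep V) (g : G) : V g * (V g).conjTranspose = 1 :=
  mul_eq_one_comm.1 (hV.unitary g)

theorem one (hV : IsUnitaryRep V) : V 1 = 1 := by
  have h : V 1 = V 1 * V 1 := by rw [← hV.mul, mul_one]
  have h2 := congrArg (fun X => (V 1).conjTranspose * X) h
  simp only [← Matrix.mul_assoc, hV.unitary, Matrix.one_mul] at h2
  exact h2.symm

theorem inv (hV : IsUnitaryRep V) (g : G) : V g⁻¹ = (V g).conjTranspose := by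
  have h : V g⁻¹ * V g = 1 := by rw [← hV.mul, inv_mul_cancel, hV.one]
  calc V g⁻¹ = V g⁻¹ * (V g * (V g).conjTranspose) := by rw [hV.mul_conjTranspose, mul_one]
    _ = _ := by rw [← Matrix.mul_assoc, h, Matrix.one_mul]

theorem kronecker_one (hV : IsUnitaryRep V) :
    IsUnitaryRep fun g => V g ⊗ₖ (1 : Matrix κ κ ℂ) where
  cont := continuous_matrix fun i j => (hV.cont.matrix_elem _ _).mul continuous_const
  unitary g := by
    rw [Matrix.conjTranspose_kronecker, ← Matrix.mul_kronecker_mul, hV.unitary]; simp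
  mul g h := by rw [← Matrix.mul_kronecker_mul, hV.mul]; simp

theorem kronecker (hV : IsUnitaryRep V) {W : G → Matrix κ κ ℂ} (hW : IsUnitaryRep W) :
    IsUnitaryRep fun g => V g ⊗ₖ W g where
  cont := continuous_matrix fun i j => (hV.cont.matrix_elem _ _).mul (hW.cont.matrix_elem _ _)
  unitary g := by
    rw [Matrix.conjTranspose_kronecker, ← Matrix.mul_kronecker_mul, hV.unitary, hW.unitary]; simp
  mul g h := by rw [← Matrix.mul_kronecker_mul, hV.mul, hW.mul]

theorem map_star (hV : IsUnitaryRep V) : IsUnitaryRep fun g => (V g).map star where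
  cont := continuous_matrix fun i j => (hV.cont.matrix_elem _ _).star
  unitary g := by
    ext i j
    have := congrArg star (congrFun (congrFun (hV.unitary g) i) j)
    simp only [Matrix.mul_apply, Matrix.conjTranspose_apply, star_sum, star_mul', star_star,
      Matrix.one_apply, apply_ite star, star_one, star_zero] at this
    simpa [Matrix.mul_apply, Matrix.one_apply] using this
  mul g h := by
    rw [hV.mul]
    ext i j
    simp [Matrix.mul_apply]

end IsUnitaryRep

omit [IsTopologicalGroup G] in
theorem posSemidef_twirl [IsFiniteMeasure μ] (hV : IsUnitaryRep V) {X : Matrix ι ι ℂ}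
    (hX : X.PosSemidef) : (twirl μ V X).PosSemidef :=
  posSemidef_avgM (hV.continuous_conj X) fun _ => hX.mul_mul_conjTranspose_same _

/-- Conjugating the average by `V h` translates the integration variable, so left invariance makes
the average a fixed point. -/
theorem commute_twirl [IsFiniteMeasure μ] [μ.IsMulLeftInvariant] (hV : IsUnitaryRep V)
    (X : Matrix ι ι ℂ) (h : G) : Commute (twirl μ V X) (V h) := by
  have key : V h * twirl μ V X * (V h).conjTranspose = twirl μ V X := by
    have := avgM_linear (μ := μ) (hV.continuous_conj X)
      (LinearMap.mulLeftRight ℂ (V h, (V h).conjTranspose))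
    simp only [LinearMap.mulLeftRight_apply] at this
    rw [twirl, this]
    ext i j
    simp only [avgM, Matrix.of_apply]
    rw [← integral_mul_left_eq_self
      (fun g => (V g * X * (V g).conjTranspose) i j) h]
    simp only [hV.mul, Matrix.conjTranspose_mul, Matrix.mul_assoc]
  calc twirl μ V X * V h = V h * twirl μ V X * (V h).conjTranspose * V h := by rw [key]
    _ = V h * twirl μ V X := by rw [Matrix.mul_assoc, hV.unitary, Matrix.mul_one]

omit [IsTopologicalGroup G] in
theorem twirl_functional [IsProbabilityMeasure μ] (hV : IsUnitaryRep V) (X : Matrix ι ι ℂ)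
    (l : Matrix ι ι ℂ →ₗ[ℂ] ℂ) (hl : ∀ g, l (V g * X * (V g).conjTranspose) = l X) :
    l (twirl μ V X) = l X := by
  rw [twirl, avgM_functional (hV.continuous_conj X)]
  simp [hl]

omit [IsTopologicalGroup G] in
theorem trLeft_twirl_kronecker [IsFiniteMeasure μ] (hV : IsUnitaryRep V) {W : G → Matrix κ κ ℂ}
    (hW : IsUnitaryRep W) (X : Matrix (ι × κ) (ι × κ) ℂ) :
    trLeft (twirl μ (fun g => V g ⊗ₖ W g) X) = twirl μ W (trLeft X) := by
  rw [twirl, trLeft_avgM ((hV.kronecker hW).continuous_conj X)]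
  simp only [trLeft_conj_unitary (hV.unitary _)]
  rfl

end twirl

/-! ### Compactness of sets of positive operators -/

section compact

variable {ι κ : Type} [Fintype ι] [Fintype κ]

/-- With X = B² and `B` Hermitian, entries of `X` are inner products of rows of `B`, whose squared
norms sum to the trace. -/
theorem Matrix.PosSemidef.norm_apply_le {X : Matrix ι ι ℂ} (hX : X.PosSemidef) (i j : ι) :
    ‖X i j‖ ≤ X.trace.re := by
  classical
  obtain ⟨B, _, hB, _⟩ := exists_sqrtPair hX
  have hs : ∀ a b, ‖B a b‖ = ‖B b a‖ := fun a b => by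
    rw [← hB.herm.apply b a, norm_star]
  have hd : ∀ a, (X a a).re = ∑ k, ‖B a k‖ ^ 2 := by
    intro a
    rw [← hB.sq, Matrix.mul_apply, Complex.re_sum]
    refine Finset.sum_congr rfl fun k _ => ?_
    rw [← hB.herm.apply k a, Complex.star_def, Complex.mul_conj, Complex.normSq_eq_norm_sq]
    exact Complex.ofReal_re _
  have ht : X.trace.re = ∑ a, ∑ k, ‖B a k‖ ^ 2 := by
    simp only [Matrix.trace, Matrix.diag_apply, Complex.re_sum, hd]
  have hle : ∀ a, ∑ k, ‖B a k‖ ^ 2 ≤ X.trace.re := fun a => by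
    rw [ht]
    exact Finset.single_le_sum (f := fun a => ∑ k, ‖B a k‖ ^ 2)
      (fun _ _ => Finset.sum_nonneg fun _ _ => sq_nonneg _) (Finset.mem_univ a)
  have h1 : ‖X i j‖ ≤ ∑ k, (‖B i k‖ ^ 2 + ‖B j k‖ ^ 2) / 2 := by
    rw [← hB.sq, Matrix.mul_apply]
    refine (norm_sum_le _ _).trans (Finset.sum_le_sum fun k _ => ?_)
    rw [norm_mul, hs k j]
    nlinarith [sq_nonneg (‖B i k‖ - ‖B j k‖)]
  rw [← Finset.sum_div, Finset.sum_add_distrib] at h1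
  linarith [hle i, hle j]

theorem isClosed_posSemidef : IsClosed {X : Matrix ι ι ℂ | X.PosSemidef} := by
  simp only [Matrix.posSemidef_iff_dotProduct_mulVec, Set.ofPred_and, Set.ofPred_forall]
  refine IsClosed.inter ?_ (isClosed_iInter fun x => ?_)
  · exact isClosed_eq continuous_id.matrix_conjTranspose continuous_id
  · exact isClosed_Ici.preimage
      (continuous_const.dotProduct (continuous_id.matrix_mulVec continuous_const))

/-- The trace is bounded on the compact set and is preserved by `t`; positivity turns this into a
bound on every entry. -/
theorem isCompact_posSemidef_preimage {t : Matrix ι ι ℂ → Matrix κ κ ℂ} (ht : Continuous t)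
    (htr : ∀ X, (t X).trace = X.trace) {K : Set (Matrix κ κ ℂ)} (hK : IsCompact K) :
    IsCompact {X : Matrix ι ι ℂ | X.PosSemidef ∧ t X ∈ K} := by
  have hc : Continuous fun Y : Matrix κ κ ℂ => Y.trace.re :=
    Complex.continuous_re.comp continuous_id.matrix_trace
  obtain ⟨c, hc⟩ := (hK.image hc).bddAbove
  have hb : IsCompact (Set.pi Set.univ fun _ : ι => Set.pi Set.univ fun _ : ι =>
      Metric.closedBall (0 : ℂ) c) :=
    isCompact_univ_pi fun _ => isCompact_univ_pi fun _ => isCompact_closedBall _ _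
  refine hb.of_isClosed_subset (isClosed_posSemidef.inter (hK.isClosed.preimage ht)) ?_
  rintro X ⟨hX, hXK⟩ i - j -
  rw [mem_closedBall_zero_iff]
  refine (hX.norm_apply_le i j).trans ?_
  exact (congrArg Complex.re (htr X)).symm.trans_le (hc ⟨_, hXK, rfl⟩)

end compact

/-! ### Normalized operators: compactness, existence and stability under averaging -/

section combs

variable {d : ℕ}

theorem sum_snoc {n : ℕ} {M : Type*} [AddCommMonoid M] (f : MIdx (n + 1) d → M) :
    ∑ x, f x = ∑ a : Fin d, ∑ y : MIdx n d, f (Fin.snoc (α := fun _ => Fin d) y a) := by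
  rw [← Fintype.sum_prod_type']
  exact (Equiv.sum_comp (Fin.snocEquiv fun _ => Fin d) f).symm

theorem tpow_one (n : ℕ) : tpow n (1 : Matrix (Fin d) (Fin d) ℂ) = 1 := by
  ext x y
  simp only [tpow, Matrix.one_apply, Finset.prod_ite_zero, funext_iff]
  simp

theorem tpow_mul (n : ℕ) (A B : Matrix (Fin d) (Fin d) ℂ) :
    tpow n (A * B) = tpow n A * tpow n B := by
  ext x y
  simp only [tpow, Matrix.mul_apply, Finset.prod_univ_sum, Fintype.piFinset_univ,
    Finset.prod_mul_distrib]

theorem tpow_conjTranspose (n : ℕ) (A : Matrix (Fin d) (Fin d) ℂ) :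
    tpow n A.conjTranspose = (tpow n A).conjTranspose := by
  ext x y
  simp [tpow]

theorem tpow_snoc {n : ℕ} (A : Matrix (Fin d) (Fin d) ℂ) (x : MIdx (n + 1) d) (y : MIdx n d)
    (a : Fin d) : tpow (n + 1) A x (Fin.snoc (α := fun _ => Fin d) y a) =
      tpow n A (Fin.init x) y * A (x (Fin.last n)) a := by
  simp [tpow, Fin.prod_univ_castSucc, Fin.init]

theorem conj_kronecker_one_apply {α β : Type} [Fintype α] [Fintype β] [DecidableEq β]
    (W : Matrix α α ℂ) (X : Matrix (α × β) (α × β) ℂ) (o o' : α) (i i' : β) :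
    ((W ⊗ₖ (1 : Matrix β β ℂ)) * X * (W ⊗ₖ (1 : Matrix β β ℂ)).conjTranspose) (o, i) (o', i') =
      ∑ p', ∑ p, W o p * X (p, i) (p', i') * star (W o' p') := by
  simp only [Matrix.mul_apply, Fintype.sum_prod_type, Matrix.kroneckerMap_apply,
    Matrix.one_apply, Matrix.conjTranspose_apply, mul_ite, mul_one, mul_zero, ite_mul, zero_mul,
    Finset.sum_ite_eq, Finset.mem_univ, if_true, Finset.sum_mul, apply_ite star, star_zero]

/-- The sum contracts the comb with identity channels in all slots. The identity on the last output
equates the two last indices, which leaves the partial trace over the last input, and induction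
applies. -/
theorem IsNormalized.sum_diagonal : ∀ {n : ℕ} {Γ : Matrix (OIIdx n d) (OIIdx n d) ℂ},
    IsNormalized d n Γ → ∑ x, ∑ y, Γ (x, x) (y, y) = 1
  | 0, Γ, h => by
    rw [IsNormalized] at h
    simp [h, Matrix.one_apply]
  | n + 1, Γ, h => by
    obtain ⟨A, Γ', -, h1, h2, h3⟩ := h
    rw [← h3.sum_diagonal]
    simp only [sum_snoc (n := n), h1, Fin.snoc_last, Fin.init_snoc]
    simp only [← h2]
    rw [Finset.sum_comm]
    refine Finset.sum_congr rfl fun x _ => ?_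
    simp only [Finset.sum_ite_irrel, Finset.sum_const_zero, Finset.sum_ite_eq, Finset.mem_univ,
      if_true]
    exact Finset.sum_comm

/-- Partial trace over the last input. -/
def trLast {n : ℕ} (A : Matrix (MIdx n d × MIdx (n + 1) d) (MIdx n d × MIdx (n + 1) d) ℂ) :
    Matrix (OIIdx n d) (OIIdx n d) ℂ :=
  fun p q => ∑ x : Fin d, A (p.1, Fin.snoc (α := fun _ => Fin d) p.2 x)
    (q.1, Fin.snoc (α := fun _ => Fin d) q.2 x)

/-- Extension by the identity on the last output. -/
def extendLast {n : ℕ} (A : Matrix (MIdx n d × MIdx (n + 1) d) (MIdx n d × MIdx (n + 1) d) ℂ) :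
    Matrix (OIIdx (n + 1) d) (OIIdx (n + 1) d) ℂ :=
  fun p q => if p.1 (Fin.last n) = q.1 (Fin.last n) then
    A (Fin.init p.1, p.2) (Fin.init q.1, q.2) else 0

/-- This form exhibits the normalized operators as the image under `extendLast` of positive
operators with normalized `trLast`, which suits the compactness argument. -/
theorem isNormalized_succ_iff {n : ℕ} {Γ : Matrix (OIIdx (n + 1) d) (OIIdx (n + 1) d) ℂ} :
    IsNormalized d (n + 1) Γ ↔ ∃ A : Matrix (MIdx n d × MIdx (n + 1) d) (MIdx n d × MIdx (n + 1) d) ℂ,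
      (A.PosSemidef ∧ IsNormalized d n (trLast A)) ∧ extendLast A = Γ := by
  rw [IsNormalized]
  constructor
  · rintro ⟨A, Γ', hA, h1, h2, h3⟩
    refine ⟨A, ⟨hA, ?_⟩, ?_⟩
    · rwa [show trLast A = Γ' from Matrix.ext fun p q => h2 p.1 q.1 p.2 q.2]
    · exact Matrix.ext fun p q => (h1 p.1 q.1 p.2 q.2).symm
  · rintro ⟨A, ⟨hA, h⟩, rfl⟩
    exact ⟨A, trLast A, hA, fun _ _ _ _ => rfl, fun _ _ _ _ => rfl, h⟩

theorem trace_trLast {n : ℕ}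
    (A : Matrix (MIdx n d × MIdx (n + 1) d) (MIdx n d × MIdx (n + 1) d) ℂ) :
    (trLast A).trace = A.trace := by
  simp only [Matrix.trace, Matrix.diag_apply, Fintype.sum_prod_type, trLast, sum_snoc (n := n)]
  exact Finset.sum_congr rfl fun _ _ => Finset.sum_comm

theorem isCompact_isNormalized : ∀ n : ℕ, IsCompact {Γ | IsNormalized d n Γ}
  | 0 => by
    simp only [IsNormalized]
    exact isCompact_singleton
  | n + 1 => by
    have ht : Continuous (trLast (d := d) (n := n)) :=
      continuous_matrix fun p q => continuous_finsetSum _ fun x _ => continuous_id.matrix_elem _ _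
    have he : Continuous (extendLast (d := d) (n := n)) :=
      continuous_matrix fun p q => by
        unfold extendLast
        split_ifs
        · exact continuous_id.matrix_elem _ _
        · exact continuous_const
    have h := (isCompact_posSemidef_preimage ht trace_trLast (isCompact_isNormalized n)).image he
    convert h using 1
    ext Γ
    exact isNormalized_succ_iff

theorem exists_isNormalized [NeZero d] : ∀ n : ℕ, ∃ Γ : Matrix (OIIdx n d) (OIIdx n d) ℂ,
    Γ.PosSemidef ∧ IsNormalized d n Γ := by
  -- The witness is the comb that feeds maximally mixed states into every slot; each traced input
  -- contributes a factor `d`.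
  have key : ∀ n : ℕ, IsNormalized d n (((d : ℂ)⁻¹ ^ n) • (1 : Matrix (OIIdx n d) (OIIdx n d) ℂ)) := by
    intro n
    induction n with
    | zero => simp [IsNormalized]
    | succ n ih =>
      refine isNormalized_succ_iff.2 ⟨((d : ℂ)⁻¹ ^ (n + 1)) • 1, ⟨?_, ?_⟩, ?_⟩
      · exact Matrix.PosSemidef.one.smul (by positivity)
      · convert ih using 1
        ext ⟨p, p'⟩ ⟨q, q'⟩
        have hd : (d : ℂ) ≠ 0 := NeZero.ne _
        have hs : ∀ x : Fin d, (Fin.snoc (α := fun _ => Fin d) p' x = Fin.snoc q' x) ↔ p' = q' :=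
          fun x => ⟨fun h => by simpa using congrArg Fin.init h, fun h => by rw [h]⟩
        simp only [trLast, Matrix.smul_apply, Matrix.one_apply, Prod.mk.injEq, hs, smul_eq_mul, Finset.sum_const, Finset.card_univ, Fintype.card_fin,
          nsmul_eq_mul, pow_succ]
        field_simp
      · ext ⟨p, p'⟩ ⟨q, q'⟩
        have : p = q ↔ p (Fin.last n) = q (Fin.last n) ∧ Fin.init p = Fin.init q := by
          constructor
          · rintro rfl; simp
          · rintro ⟨h1, h2⟩
            rw [← Fin.snoc_init_self p, ← Fin.snoc_init_self q, h1, h2]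
        simp only [extendLast, Matrix.smul_apply, Matrix.one_apply, Prod.mk.injEq, this]
        by_cases h : p (Fin.last n) = q (Fin.last n) <;> simp [h]
  exact fun n => ⟨_, Matrix.PosSemidef.one.smul (by positivity), key n⟩

variable {G : Type*} [Group G] [TopologicalSpace G]

theorem IsUnitaryRep.tpow {U : G → Matrix (Fin d) (Fin d) ℂ} (hU : IsUnitaryRep U) (n : ℕ) :
    IsUnitaryRep fun g => tpow n (U g) where
  cont := continuous_matrix fun i j => continuous_finsetProd _ fun k _ => hU.cont.matrix_elem _ _
  unitary g := by rw [← tpow_conjTranspose, ← tpow_mul, hU.unitary, tpow_one]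
  mul g h := by rw [hU.mul, tpow_mul]

theorem trLast_conj {n : ℕ} (W : Matrix (MIdx n d) (MIdx n d) ℂ)
    (A : Matrix (MIdx n d × MIdx (n + 1) d) (MIdx n d × MIdx (n + 1) d) ℂ) :
    trLast ((W ⊗ₖ 1) * A * (W ⊗ₖ (1 : Matrix (MIdx (n + 1) d) (MIdx (n + 1) d) ℂ)).conjTranspose) =
      (W ⊗ₖ 1) * trLast A * (W ⊗ₖ (1 : Matrix (MIdx n d) (MIdx n d) ℂ)).conjTranspose := by
  ext ⟨o, i⟩ ⟨o', i'⟩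
  rw [conj_kronecker_one_apply]
  simp only [trLast, conj_kronecker_one_apply, Finset.mul_sum, Finset.sum_mul]
  rw [Finset.sum_comm]
  exact Finset.sum_congr rfl fun _ _ => Finset.sum_comm

/-- The last output carries the identity, which conjugation by a unitary fixes; only the other
outputs are affected. -/
theorem extendLast_conj {n : ℕ} {U : Matrix (Fin d) (Fin d) ℂ} (hU : U * U.conjTranspose = 1)
    (A : Matrix (MIdx n d × MIdx (n + 1) d) (MIdx n d × MIdx (n + 1) d) ℂ) :
    extendLast (((tpow n U).map star ⊗ₖ 1) * A *
        ((tpow n U).map star ⊗ₖ (1 : Matrix (MIdx (n + 1) d) (MIdx (n + 1) d) ℂ)).conjTranspose) =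
      ((tpow (n + 1) U).map star ⊗ₖ 1) * extendLast A * ((tpow (n + 1) U).map star ⊗ₖ
        (1 : Matrix (MIdx (n + 1) d) (MIdx (n + 1) d) ℂ)).conjTranspose := by
  ext ⟨o, i⟩ ⟨o', i'⟩
  rw [conj_kronecker_one_apply]
  simp only [extendLast, conj_kronecker_one_apply, sum_snoc (n := n), Matrix.map_apply, tpow_snoc,
    Fin.snoc_last, Fin.init_snoc, star_mul', star_star]
  set a := o (Fin.last n)
  set a' := o' (Fin.last n)
  have hU' : ∑ b, U a' b * star (U a b) = if a = a' then 1 else 0 := by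
    have := congrFun (congrFun hU a') a
    simp only [Matrix.mul_apply, Matrix.conjTranspose_apply, Matrix.one_apply] at this
    rw [this]
    simp only [eq_comm]
  calc _ = (∑ b, U a' b * star (U a b)) * ∑ p', ∑ p, star (tpow n U (Fin.init o) p) *
        A (p, i) (p', i') * tpow n U (Fin.init o') p' := by rw [hU']; split_ifs <;> simp
    _ = _ := by
      simp only [Finset.sum_mul, Finset.mul_sum, mul_ite, ite_mul, mul_zero, zero_mul]
      simp only [Finset.sum_ite_irrel, Finset.sum_const_zero, Finset.sum_ite_eq', Finset.mem_univ,
        if_true]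
      rw [Finset.sum_comm (s := (Finset.univ : Finset (Fin d)))]
      refine Finset.sum_congr rfl fun p' _ => ?_
      rw [Finset.sum_comm]
      refine Finset.sum_congr rfl fun b _ => Finset.sum_congr rfl fun p _ => ?_
      ring

variable [CompactSpace G] [MeasurableSpace G] [BorelSpace G] {μ : Measure G}
  [IsProbabilityMeasure μ]

/-- The group acts on outputs alone, so averaging commutes with tracing the last input and with
adjoining an identity output. The recursion thus passes to the average. -/
theorem isNormalized_twirl {U : G → Matrix (Fin d) (Fin d) ℂ} (hU : IsUnitaryRep U) :
    ∀ {n : ℕ} {Γ : Matrix (OIIdx n d) (OIIdx n d) ℂ}, IsNormalized d n Γ →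
      IsNormalized d n (twirl μ (fun g => (tpow n (U g)).map star ⊗ₖ 1) Γ)
  | 0, Γ, h => by
    rw [IsNormalized] at h ⊢
    subst h
    have hV := ((hU.tpow 0).map_star).kronecker_one (κ := MIdx 0 d)
    simp only [twirl, Matrix.mul_one, hV.mul_conjTranspose]
    exact avgM_const _
  | n + 1, Γ, h => by
    obtain ⟨A, ⟨hA, h'⟩, rfl⟩ := isNormalized_succ_iff.1 h
    have hV := ((hU.tpow n).map_star).kronecker_one (κ := MIdx (n + 1) d)
    refine isNormalized_succ_iff.2 ⟨_, ⟨posSemidef_twirl (μ := μ) hV hA, ?_⟩, ?_⟩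
    · convert isNormalized_twirl hU h' using 1
      simp only [twirl, ← trLast_conj]
      ext p q
      exact (integral_finsetSum _ fun a _ => integrable_of_continuous
        ((hV.continuous_conj A).matrix_elem _ _)).symm
    · simp only [twirl, ← extendLast_conj (hU.mul_conjTranspose _)]
      ext p q
      simp only [extendLast, avgM, Matrix.of_apply]
      split_ifs
      · rfl
      · simp

end combs

/-! ### Inverting an isometric storage; composing storage and retrieval -/

section channels

variable {α β γ : Type} [Fintype α] [Fintype β] [Fintype γ] [DecidableEq α] [DecidableEq β]
  [DecidableEq γ]

omit [DecidableEq β] in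
theorem link_add (C D : Matrix (α × β) (α × β) ℂ) (ρ : Matrix β β ℂ) :
    link (C + D) ρ = link C ρ + link D ρ := by
  ext a a'
  simp [link_apply, add_mul, Finset.sum_add_distrib]

omit [DecidableEq β] in
theorem link_kronecker_transpose (τ : Matrix α α ℂ) (P ρ : Matrix β β ℂ) :
    link (τ ⊗ₖ P.transpose) ρ = (P * ρ).trace • τ := by
  ext a a'
  simp only [link_apply, Matrix.kroneckerMap_apply, Matrix.transpose_apply, Matrix.smul_apply,
    smul_eq_mul, Matrix.trace, Matrix.diag_apply, Matrix.mul_apply, Finset.sum_mul]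
  rw [Finset.sum_comm]
  refine Finset.sum_congr rfl fun c' _ => Finset.sum_congr rfl fun c _ => ?_
  ring

omit [DecidableEq β] in
theorem SqrtPair.one_kronecker {Γ R Q : Matrix β β ℂ} (h : SqrtPair Γ R Q) :
    SqrtPair ((1 : Matrix α α ℂ) ⊗ₖ Γ) ((1 : Matrix α α ℂ) ⊗ₖ R) ((1 : Matrix α α ℂ) ⊗ₖ Q) where
  herm := by
    rw [Matrix.IsHermitian, Matrix.conjTranspose_kronecker, h.herm.eq, Matrix.conjTranspose_one]
  herm_inv := by
    rw [Matrix.IsHermitian, Matrix.conjTranspose_kronecker, h.herm_inv.eq,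
      Matrix.conjTranspose_one]
  sq := by rw [← Matrix.mul_kronecker_mul, h.sq, Matrix.one_mul]
  comm := by simp only [← Matrix.mul_kronecker_mul, h.comm]
  left := by simp only [← Matrix.mul_kronecker_mul, h.left, Matrix.one_mul]
  right := by simp only [← Matrix.mul_kronecker_mul, h.right, Matrix.one_mul]

/-- The polar decomposition of `A`, as a channel that undoes its partial isometry. -/
theorem exists_polar_channel [Nonempty β] {A : Matrix α β ℂ} {R Q : Matrix β β ℂ}
    (h : SqrtPair (trLeft (proj (dket A))) R Q) :
    ∃ E : Matrix (β × α) (β × α) ℂ, IsChannel E ∧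
      ∀ v : β → ℂ, link E (A * proj v * A.conjTranspose) = R.transpose * proj v * R.transpose := by
  have hA : A.conjTranspose * A = R.transpose * R.transpose := by
    have := h.sq
    rw [trLeft_proj_dket] at this
    rw [← Matrix.transpose_mul, this, Matrix.transpose_transpose]
  have hQh : Q.transpose.conjTranspose = Q.transpose := h.herm_inv.transpose.eq
  have hRh : R.transpose.conjTranspose = R.transpose := h.herm.transpose.eq
  have hl : R.transpose * Q.transpose * R.transpose = R.transpose := by
    simp only [← Matrix.transpose_mul, ← Matrix.mul_assoc, h.left]
  have hr : Q.transpose * R.transpose * Q.transpose = Q.transpose := by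
    simp only [← Matrix.transpose_mul, ← Matrix.mul_assoc, h.right]
  have hc : R.transpose * Q.transpose = Q.transpose * R.transpose := by
    simp only [← Matrix.transpose_mul, h.comm]
  generalize R.transpose = r at *
  generalize Q.transpose = q at *
  -- The partial isometry in the polar decomposition A = W r. The wanted channel is X ↦ W†XW,
  -- completed by a fixed output state on the complement of the range of `W`, where `A` has no
  -- component.
  set W := A * q with hW
  have hWW : W.conjTranspose * W = q * r := by
    rw [hW, Matrix.conjTranspose_mul, hQh, Matrix.mul_assoc, ← Matrix.mul_assoc _ A, hA]
    calc q * (r * r * q) = q * r * (r * q) := by simp only [Matrix.mul_assoc]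
      _ = q * r * q * r := by rw [hc, ← Matrix.mul_assoc]
      _ = q * r := by rw [hr]
  have hWqr : W * (q * r) = W := by
    rw [hW, Matrix.mul_assoc, ← hc, ← Matrix.mul_assoc q, hr]
  have hWA : W.conjTranspose * A = r := by
    rw [hW, Matrix.conjTranspose_mul, hQh, Matrix.mul_assoc, hA, ← Matrix.mul_assoc, ← hc, hl]
  have hAr : A * (1 - q * r) = 0 := by
    rw [← Matrix.conjTranspose_mul_self_eq_zero, Matrix.conjTranspose_mul, Matrix.mul_assoc,
      ← Matrix.mul_assoc _ A, hA]
    have : r * (1 - q * r) = 0 := by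
      rw [Matrix.mul_sub, ← Matrix.mul_assoc, hl, Matrix.mul_one, sub_self]
    rw [Matrix.mul_assoc r, this, Matrix.mul_zero, Matrix.mul_zero]
  have hWrA : W * r = A := by
    rw [Matrix.mul_sub, Matrix.mul_one, sub_eq_zero, ← Matrix.mul_assoc] at hAr
    exact hAr.symm
  set P : Matrix α α ℂ := 1 - W * W.conjTranspose with hP
  have hPh : P.conjTranspose = P := by
    simp [hP, Matrix.conjTranspose_sub, Matrix.conjTranspose_mul]
  have hPW : P * W = 0 := by
    rw [hP, Matrix.sub_mul, Matrix.mul_assoc, hWW, hWqr, Matrix.one_mul, sub_self]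
  have hPP : P.conjTranspose * P = P := by
    rw [hPh]
    nth_rw 2 [hP]
    rw [Matrix.mul_sub, ← Matrix.mul_assoc, hPW]
    simp
  have hPpos : P.PosSemidef := by
    have := Matrix.posSemidef_conjTranspose_mul_self P
    rwa [hPP] at this
  have hPA : P * A = 0 := by rw [← hWrA, ← Matrix.mul_assoc, hPW, Matrix.zero_mul]
  obtain ⟨b₀⟩ := ‹Nonempty β›
  refine ⟨proj (dket W.conjTranspose) + Matrix.single b₀ b₀ 1 ⊗ₖ P.transpose, ⟨?_, ?_⟩, ?_⟩
  · exact (proj_posSemidef _).add ((posSemidef_single b₀).kronecker hPpos.transpose)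
  · rw [trLeft_add, trLeft_kronecker, trLeft_proj_dket, Matrix.trace_single_eq_same, one_smul,
      ← Matrix.transpose_add, hP]
    simp
  · intro v
    rw [link_add, link_proj_dket, link_kronecker_transpose]
    have e1 : P * (A * proj v * A.conjTranspose) = 0 := by
      rw [← Matrix.mul_assoc, ← Matrix.mul_assoc, hPA]; simp
    have e2 : A.conjTranspose * W = r := by
      have := congrArg Matrix.conjTranspose hWA
      rwa [Matrix.conjTranspose_mul, Matrix.conjTranspose_conjTranspose, hRh] at this
    rw [e1, Matrix.trace_zero, zero_smul, add_zero, Matrix.conjTranspose_conjTranspose]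
    calc _ = (W.conjTranspose * A) * proj v * (A.conjTranspose * W) := by
          simp only [Matrix.mul_assoc]
      _ = _ := by rw [hWA, e2]

/-- The operator of the composition of a storing board and a retrieving channel. -/
def linkComp (R : Matrix (α × γ) (α × γ) ℂ) (S : Matrix (γ × β) (γ × β) ℂ) :
    Matrix (α × β) (α × β) ℂ :=
  fun p q => ∑ m, ∑ m', R (p.1, m) (q.1, m') * S (m, p.2) (m', q.2)

omit [DecidableEq β] in
theorem link_link (R : Matrix (α × γ) (α × γ) ℂ) (S : Matrix (γ × β) (γ × β) ℂ)
    (ρ : Matrix β β ℂ) : link R (link S ρ) = link (linkComp R S) ρ := by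
  ext a a'
  simp only [link_apply, linkComp, Finset.mul_sum, Finset.sum_mul, mul_assoc]
  have h : ∀ f : γ → γ → β → β → ℂ,
      ∑ m, ∑ m', ∑ b, ∑ b', f m m' b b' = ∑ b, ∑ b', ∑ m, ∑ m', f m m' b b' := by
    intro f
    simp only [← Fintype.sum_prod_type']
    exact Fintype.sum_equiv
      { toFun := fun x => (x.2.2.1, x.2.2.2, x.1, x.2.1)
        invFun := fun x => (x.2.2.1, x.2.2.2, x.1, x.2.1)
        left_inv := fun _ => rfl
        right_inv := fun _ => rfl } _ _ fun _ => rfl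
  exact h fun m m' b b' => R (a, m) (a', m') * (S (m, b) (m', b') * ρ b b')

theorem posSemidef_linkComp {R : Matrix (α × γ) (α × γ) ℂ} {S : Matrix (γ × β) (γ × β) ℂ}
    (hR : R.PosSemidef) (hS : S.PosSemidef) : (linkComp R S).PosSemidef := by
  -- `Z` contracts the two copies of the memory, so the composition is a compression of the positive
  -- operator R ⊗ S.
  obtain ⟨Z, hZ⟩ : ∃ Z : Matrix (α × β) ((α × γ) × (γ × β)) ℂ, ∀ p q, Z p q =
      if p.1 = q.1.1 then if q.1.2 = q.2.1 then if p.2 = q.2.2 then 1 else 0 else 0 else 0 :=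
    ⟨_, fun _ _ => rfl⟩
  have h : linkComp R S = Z * (R ⊗ₖ S) * Z.conjTranspose := by
    ext ⟨a, b⟩ ⟨a', b'⟩
    simp only [linkComp, hZ, Matrix.mul_apply, Fintype.sum_prod_type, Matrix.kroneckerMap_apply,
      Matrix.conjTranspose_apply, apply_ite star, star_one, star_zero, ite_mul, mul_ite,
      one_mul, mul_one, zero_mul, mul_zero, Finset.sum_ite_irrel, Finset.sum_const_zero,
      Finset.sum_ite_eq, Finset.mem_univ, if_true]
    exact Finset.sum_comm
  rw [h]
  exact (hR.kronecker hS).mul_mul_conjTranspose_same Z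

end channels

/-! ### The parallel input state and its board -/

section board

variable {N d : ℕ}

theorem dket_eq_mulVec {α : Type} [Fintype α] [DecidableEq α] (A : Matrix α α ℂ) :
    dket A = (A ⊗ₖ (1 : Matrix α α ℂ)).mulVec (dket 1) := by
  ext ⟨a, b⟩
  simp [dket, Matrix.mulVec, dotProduct, Fintype.sum_prod_type, Matrix.one_apply]

/-- The squared norm is ⟨⟨I|Γᵀ|I⟩⟩, the contraction computed by `IsNormalized.sum_diagonal`. -/
theorem IsNormalized.unit_vector {Γ R Q : Matrix (OIIdx N d) (OIIdx N d) ℂ}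
    (hn : IsNormalized d N Γ) (h : SqrtPair Γ R Q) :
    star (R.transpose.mulVec (dket 1)) ⬝ᵥ R.transpose.mulVec (dket 1) = 1 := by
  rw [Matrix.star_mulVec, ← Matrix.dotProduct_mulVec, Matrix.mulVec_mulVec,
    h.herm.transpose.eq, ← Matrix.transpose_mul, h.sq, ← hn.sum_diagonal]
  simp only [dotProduct, Matrix.mulVec, Fintype.sum_prod_type, dket, Matrix.one_apply,
    Pi.star_apply, apply_ite star, star_one, star_zero, ite_mul, one_mul, zero_mul,
    Finset.sum_ite_eq, Finset.mem_univ, if_true, mul_ite, mul_one, mul_zero,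
    Matrix.transpose_apply]
  exact Finset.sum_comm

variable {G : Type*} [Group G] [TopologicalSpace G] {U : G → Matrix (Fin d) (Fin d) ℂ}

theorem sqrt_examples (hU : IsUnitaryRep U) {Γ R Q : Matrix (OIIdx N d) (OIIdx N d) ℂ}
    (h : SqrtPair Γ R Q)
    (hc : ∀ g, Commute R ((tpow N (U g)).map star ⊗ₖ (1 : Matrix (MIdx N d) (MIdx N d) ℂ)))
    (g : G) : R.transpose * examples N (U g) * R.transpose =
      proj (parallelState N (U g) (R.transpose.mulVec (dket 1))) := by
  -- Transposition turns U* into U†, so the commutation of `R` is needed at g⁻¹ to get U_g itself.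
  have hW : ((tpow N (U g⁻¹)).map star ⊗ₖ (1 : Matrix (MIdx N d) (MIdx N d) ℂ)).transpose =
      tpow N (U g) ⊗ₖ (1 : Matrix (MIdx N d) (MIdx N d) ℂ) := by
    rw [(hU.tpow N).inv]
    ext ⟨a, b⟩ ⟨a', b'⟩
    simp [Matrix.one_apply, eq_comm]
  have hcomm : R.transpose * (tpow N (U g) ⊗ₖ (1 : Matrix (MIdx N d) (MIdx N d) ℂ)) =
      (tpow N (U g) ⊗ₖ (1 : Matrix (MIdx N d) (MIdx N d) ℂ)) * R.transpose := by
    rw [← hW, ← Matrix.transpose_mul, ← Matrix.transpose_mul, (hc g⁻¹).eq]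
  have := mul_proj_mul R.transpose (dket (tpow N (U g)))
  rw [h.herm.transpose.eq] at this
  rw [examples, this, parallelState, dket_eq_mulVec, Matrix.mulVec_mulVec, Matrix.mulVec_mulVec,
    hcomm]

/-- The parallel board in which the memory has the dimension of all inputs and outputs. -/
theorem exists_parallel_board {Γ R Q : Matrix (OIIdx N d) (OIIdx N d) ℂ}
    (h : SqrtPair Γ R Q) (hn : IsNormalized d N Γ)
    {R' : Matrix ((Fin d × Fin d) × OIIdx N d) ((Fin d × Fin d) × OIIdx N d) ℂ}
    (hR' : IsRetrieving d R') :
    ∃ (m : ℕ) (S : Matrix (Fin m × OIIdx N d) (Fin m × OIIdx N d) ℂ)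
      (T : Matrix ((Fin d × Fin d) × Fin m) ((Fin d × Fin d) × Fin m) ℂ),
      IsStoringComb N d m S ∧ IsRetrieving d T ∧
      ∀ ρ, link T (link S ρ) = link R' (R.transpose * ρ * R.transpose) := by
  let e := Fintype.equivFin (OIIdx N d)
  -- The pure comb |Rᵀ⟩⟩⟨⟨Rᵀ| has marginal R² = Γ, hence is a legitimate board; the bijection `e`
  -- only relabels the memory basis by `Fin m`.
  refine ⟨_, proj (dket (R.transpose.submatrix e.symm id)),
    R'.submatrix (Prod.map id e.symm) (Prod.map id e.symm), ⟨proj_posSemidef _, ?_⟩, ⟨?_, ?_⟩, ?_⟩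
  · convert hn using 1
    rw [trLeft_proj_dket, Matrix.conjTranspose_submatrix, Matrix.submatrix_mul_equiv,
      h.herm.transpose.eq, Matrix.submatrix_id_id, Matrix.transpose_mul, ← h.sq]
    rfl
  · exact hR'.1.submatrix
      (Prod.map id (Prod.map id e.symm) : Fin d × Fin d × Fin _ → Fin d × Fin d × OIIdx N d)
  · ext ⟨b, c⟩ ⟨b', c'⟩
    have := congrFun (congrFun hR'.2 (b, e.symm c)) (b', e.symm c')
    simp only [Matrix.one_apply, Prod.mk.injEq, e.symm.injective.eq_iff] at this ⊢
    exact this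
  · intro ρ
    rw [link_proj_dket]
    have : R.transpose.submatrix e.symm id * ρ * (R.transpose.submatrix e.symm id).conjTranspose =
        (R.transpose * ρ * R.transpose).submatrix e.symm e.symm := by
      rw [Matrix.conjTranspose_submatrix, h.herm.transpose.eq]
      rfl
    rw [this]
    ext a a'
    simp only [link_apply, Matrix.submatrix_apply, Prod.map_apply, id_eq]
    rw [e.symm.sum_comp fun b => ∑ c : Fin _, R' (a, b) (a', e.symm c) *
      (R.transpose * ρ * R.transpose) b (e.symm c)]
    exact Finset.sum_congr rfl fun b _ => e.symm.sum_comp fun c =>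
      R' (a, b) (a', c) * (R.transpose * ρ * R.transpose) b c

end board

theorem posSemidef_trLeft {α β : Type} [Fintype α] {X : Matrix (α × β) (α × β) ℂ}
    (hX : X.PosSemidef) : (trLeft X).PosSemidef := by
  have h : trLeft X = ∑ a, X.submatrix (Prod.mk a) (Prod.mk a) := by
    ext b b'
    simp [trLeft, Matrix.sum_apply]
  rw [h]
  exact Matrix.posSemidef_sum _ fun a _ => hX.submatrix _

theorem kronecker_mulVec_mul {α β : Type} [Fintype α] [Fintype β] (A : Matrix α α ℂ)
    (B : Matrix β β ℂ) (x : α → ℂ) (y : β → ℂ) :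
    (A ⊗ₖ B).mulVec (fun p => x p.1 * y p.2) = fun p => A.mulVec x p.1 * B.mulVec y p.2 := by
  ext ⟨a, b⟩
  simp only [Matrix.mulVec, dotProduct, Fintype.sum_prod_type, Matrix.kroneckerMap_apply,
    Finset.sum_mul_sum]
  exact Finset.sum_congr rfl fun _ _ => Finset.sum_congr rfl fun _ _ => by ring

theorem dket_mul {α : Type} [Fintype α] [DecidableEq α] (A B : Matrix α α ℂ) :
    dket (A * B) = (A ⊗ₖ (1 : Matrix α α ℂ)).mulVec (dket B) := by
  ext ⟨a, b⟩
  simp [dket, Matrix.mulVec, dotProduct, Fintype.sum_prod_type, Matrix.one_apply, Matrix.mul_apply]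

/-! ### The average fidelity as an invariant linear functional -/

section fidelity

variable {N d : ℕ}

/-- The operators of a learning process, regrouped as output and inputs of the retrieval. -/
abbrev regroup {α β γ : Type} (L : Matrix ((α × β) × γ) ((α × β) × γ) ℂ) :
    Matrix (α × β × γ) (α × β × γ) ℂ :=
  L.submatrix (Equiv.prodAssoc _ _ _).symm (Equiv.prodAssoc _ _ _).symm

variable (N) in
/-- The vector whose expectation value in a learning comb is the (unnormalized) fidelity. -/
def fidVec (A : Matrix (Fin d) (Fin d) ℂ) : (Fin d × Fin d) × OIIdx N d → ℂ :=
  fun p => dket A p.1 * star (dket (tpow N A)) p.2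

variable (N) in
/-- The action of a unitary on the learning combs. -/
def combAct (A : Matrix (Fin d) (Fin d) ℂ) :
    Matrix ((Fin d × Fin d) × OIIdx N d) ((Fin d × Fin d) × OIIdx N d) ℂ :=
  (A ⊗ₖ (1 : Matrix (Fin d) (Fin d) ℂ)) ⊗ₖ
    ((tpow N A).map star ⊗ₖ (1 : Matrix (MIdx N d) (MIdx N d) ℂ))

theorem fidVec_mul (A B : Matrix (Fin d) (Fin d) ℂ) :
    fidVec N (A * B) = (combAct N A).mulVec (fidVec N B) := by
  unfold combAct fidVec
  rw [kronecker_mulVec_mul, tpow_mul, dket_mul, dket_mul]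
  ext ⟨p, q⟩
  congr 1
  rw [Matrix.star_mulVec, ← Matrix.mulVec_transpose]
  congr 1
  ext ⟨a, b⟩ ⟨a', b'⟩
  by_cases hb : b = b' <;> simp [hb]

theorem fidelity_eq (A : Matrix (Fin d) (Fin d) ℂ)
    (L : Matrix ((Fin d × Fin d) × OIIdx N d) ((Fin d × Fin d) × OIIdx N d) ℂ) :
    star (dket A) ⬝ᵥ (link L (examples N A)).mulVec (dket A) =
      star (fidVec N A) ⬝ᵥ L.mulVec (fidVec N A) := by
  simp only [dotProduct, Matrix.mulVec, link_apply, examples, proj, Matrix.vecMulVec_apply, fidVec,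
    Pi.star_apply, star_mul', star_star, Finset.mul_sum, Finset.sum_mul]
  simp only [Fintype.sum_prod_type (α₁ := Fin d × Fin d)]
  refine Finset.sum_congr rfl fun p _ => ?_
  rw [Finset.sum_comm]
  refine Finset.sum_congr rfl fun b _ => Finset.sum_congr rfl fun p' _ =>
    Finset.sum_congr rfl fun b' _ => ?_
  ring

variable {G : Type*} [Group G] [TopologicalSpace G] {U : G → Matrix (Fin d) (Fin d) ℂ}

theorem IsUnitaryRep.combAct (hU : IsUnitaryRep U) : IsUnitaryRep fun g => combAct N (U g) :=
  hU.kronecker_one.kronecker ((hU.tpow N).map_star).kronecker_one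

theorem IsUnitaryRep.continuous_fidVec (hU : IsUnitaryRep U)
    (p : (Fin d × Fin d) × OIIdx N d) : Continuous fun g => fidVec N (U g) p :=
  (hU.cont.matrix_elem _ _).mul ((hU.tpow N).cont.matrix_elem _ _).star

variable [CompactSpace G] [MeasurableSpace G] [BorelSpace G]

theorem integrable_fidelity (μ : Measure G) [IsFiniteMeasure μ] (hU : IsUnitaryRep U)
    (L : Matrix ((Fin d × Fin d) × OIIdx N d) ((Fin d × Fin d) × OIIdx N d) ℂ) :
    Integrable (fun g => star (fidVec N (U g)) ⬝ᵥ L.mulVec (fidVec N (U g))) μ := by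
  have h : Continuous fun g => fidVec N (U g) := continuous_pi hU.continuous_fidVec
  exact integrable_of_continuous (h.star.dotProduct (continuous_const.matrix_mulVec h))

/-- The integrated fidelity as a linear functional of the learning comb. -/
noncomputable def fidFunctional (N : ℕ) (μ : Measure G) [IsFiniteMeasure μ] (hU : IsUnitaryRep U) :
    Matrix ((Fin d × Fin d) × OIIdx N d) ((Fin d × Fin d) × OIIdx N d) ℂ →ₗ[ℂ] ℂ where
  toFun L := ∫ g, star (fidVec N (U g)) ⬝ᵥ L.mulVec (fidVec N (U g)) ∂μ
  map_add' L L' := by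
    simp only [Matrix.add_mulVec, dotProduct_add]
    exact integral_add (integrable_fidelity μ hU L) (integrable_fidelity μ hU L')
  map_smul' c L := by
    simp only [Matrix.smul_mulVec, dotProduct_smul]
    exact integral_smul _ _

theorem avgFidelity_eq (μ : Measure G) [IsFiniteMeasure μ] (hU : IsUnitaryRep U)
    (L : Matrix ((Fin d × Fin d) × OIIdx N d) ((Fin d × Fin d) × OIIdx N d) ℂ) :
    avgFidelity μ U (fun g => link L (examples N (U g))) =
      (fidFunctional N μ hU L).re / (d : ℝ) ^ 2 := by
  unfold avgFidelity
  congr 1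
  simp only [fidelity_eq]
  exact integral_re (integrable_fidelity μ hU L)

variable [IsTopologicalGroup G] (μ : Measure G) [IsProbabilityMeasure μ] [μ.IsMulLeftInvariant]

/-- Conjugating the comb by the action of `h` is the same as translating the fidelity vector by h⁻¹,
which the invariant integral does not see. -/
theorem avgFidelity_twirl (hU : IsUnitaryRep U)
    (L : Matrix ((Fin d × Fin d) × OIIdx N d) ((Fin d × Fin d) × OIIdx N d) ℂ) :
    avgFidelity μ U (fun g => link (twirl μ (fun g => combAct N (U g)) L) (examples N (U g))) =
      avgFidelity μ U (fun g => link L (examples N (U g))) := by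
  rw [avgFidelity_eq μ hU, avgFidelity_eq μ hU, twirl_functional hU.combAct]
  intro h
  change ∫ g, _ ∂μ = ∫ g, _ ∂μ
  rw [← integral_mul_left_eq_self _ h]
  refine integral_congr_ae (Filter.Eventually.of_forall fun g => ?_)
  have e : (combAct N (U h)).conjTranspose.mulVec (fidVec N (U (h * g))) = fidVec N (U g) := by
    rw [hU.mul, fidVec_mul, Matrix.mulVec_mulVec, hU.combAct.unitary, Matrix.one_mulVec]
  have e' : Matrix.vecMul (star (fidVec N (U (h * g)))) (combAct N (U h)) =
      star (fidVec N (U g)) := by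
    rw [← e, Matrix.star_mulVec, Matrix.conjTranspose_conjTranspose]
  simp only
  rw [← Matrix.mulVec_mulVec, e, ← Matrix.mulVec_mulVec, Matrix.dotProduct_mulVec, e']

omit [IsTopologicalGroup G] [μ.IsMulLeftInvariant] in
-- The action is unitary on the traced output and trivial on H_{2N+2}, so only its part on the slots
-- survives, averaging Γ.
theorem trLeft_regroup_twirl (hU : IsUnitaryRep U)
    {L : Matrix ((Fin d × Fin d) × OIIdx N d) ((Fin d × Fin d) × OIIdx N d) ℂ}
    {Γ : Matrix (OIIdx N d) (OIIdx N d) ℂ}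
    (h : trLeft (regroup L) = (1 : Matrix (Fin d) (Fin d) ℂ) ⊗ₖ Γ) :
    trLeft (regroup (twirl μ (fun g => combAct N (U g)) L)) = (1 : Matrix (Fin d) (Fin d) ℂ) ⊗ₖ
      twirl μ (fun g => (tpow N (U g)).map star ⊗ₖ (1 : Matrix (MIdx N d) (MIdx N d) ℂ)) Γ := by
  have hW := ((hU.tpow N).map_star).kronecker_one (κ := MIdx N d)
  have hT : IsUnitaryRep fun g => (1 : Matrix (Fin d) (Fin d) ℂ) ⊗ₖ
      ((tpow N (U g)).map star ⊗ₖ (1 : Matrix (MIdx N d) (MIdx N d) ℂ)) :=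
    IsUnitaryRep.kronecker ⟨continuous_const, by simp, by simp⟩ hW
  have e : regroup (twirl μ (fun g => combAct N (U g)) L) = twirl μ (fun g => U g ⊗ₖ
      ((1 : Matrix (Fin d) (Fin d) ℂ) ⊗ₖ ((tpow N (U g)).map star ⊗ₖ
        (1 : Matrix (MIdx N d) (MIdx N d) ℂ)))) (regroup L) := by
    ext p q
    simp only [twirl, avgM, regroup, Matrix.of_apply, Matrix.submatrix_apply]
    refine integral_congr_ae (Filter.Eventually.of_forall fun g => ?_)
    simp only
    rw [← Matrix.kronecker_assoc, Matrix.reindex_apply, Matrix.conjTranspose_submatrix,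
      Matrix.submatrix_mul_equiv, Matrix.submatrix_mul_equiv]
    rfl
  rw [e, trLeft_twirl_kronecker hU hT, h]
  ext ⟨a, b⟩ ⟨a', b'⟩
  simp only [twirl, avgM, Matrix.of_apply, Matrix.kroneckerMap_apply, ← integral_const_mul]
  refine integral_congr_ae (Filter.Eventually.of_forall fun g => ?_)
  simp only
  rw [Matrix.conjTranspose_kronecker, ← Matrix.mul_kronecker_mul, ← Matrix.mul_kronecker_mul]
  simp

end fidelity

/-! ### Learning combs -/

section learning

variable {N d : ℕ}

/-- The marginal I ⊗ Γ has root I ⊗ R, which does not touch H_{2N+2}. The channel left after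
extracting it therefore has the unknown input and the stored state as its two inputs. -/
theorem exists_retrieving_factor [NeZero d]
    {L : Matrix ((Fin d × Fin d) × OIIdx N d) ((Fin d × Fin d) × OIIdx N d) ℂ}
    (hL : L.PosSemidef) {Γ R Q : Matrix (OIIdx N d) (OIIdx N d) ℂ} (h : SqrtPair Γ R Q)
    (ht : trLeft (regroup L) = (1 : Matrix (Fin d) (Fin d) ℂ) ⊗ₖ Γ) :
    ∃ R' : Matrix ((Fin d × Fin d) × OIIdx N d) ((Fin d × Fin d) × OIIdx N d) ℂ,
      IsRetrieving d R' ∧ ∀ ρ, link L ρ = link R' (R.transpose * ρ * R.transpose) := by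
  have hs := h.one_kronecker (α := Fin d)
  rw [← ht] at hs
  obtain ⟨D, hD, hX⟩ := exists_channel_factor (hL.submatrix _) hs
  let e := Equiv.prodAssoc (Fin d) (Fin d) (OIIdx N d)
  refine ⟨D.submatrix e e, ?_, fun ρ => ?_⟩
  · rw [IsRetrieving, Matrix.submatrix_submatrix]
    simpa [e] using hD
  · rw [← link_one_kronecker_conj]
    congr 1
    have h1 : ((1 : Matrix (Fin d) (Fin d) ℂ) ⊗ₖ ((1 : Matrix (Fin d) (Fin d) ℂ) ⊗ₖ R)).submatrix
        e e = (1 : Matrix (Fin d × Fin d) (Fin d × Fin d) ℂ) ⊗ₖ R := by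
      rw [← Matrix.one_kronecker_one, ← Matrix.kronecker_assoc, Matrix.reindex_apply,
        Matrix.submatrix_submatrix]
      simp [e]
    have h2 := congrArg (fun X => X.submatrix e e) hX
    simp only [← Matrix.submatrix_mul_equiv _ _ e e e, h1] at h2
    rw [← h2]
    rfl

/-- Discarding the output of the retrieval also discards the memory. The resulting Γ depends on the
board only, which is why one φ can serve all retrieving channels. -/
theorem isLearningComb_linkComp {m : ℕ} {S : Matrix (Fin m × OIIdx N d) (Fin m × OIIdx N d) ℂ}
    {R : Matrix ((Fin d × Fin d) × Fin m) ((Fin d × Fin d) × Fin m) ℂ}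
    (hS : IsStoringComb N d m S) (hR : IsRetrieving d R) :
    (linkComp R S).PosSemidef ∧
      trLeft (regroup (linkComp R S)) = (1 : Matrix (Fin d) (Fin d) ℂ) ⊗ₖ trLeft S := by
  have hRp : R.PosSemidef := by
    have := hR.1.submatrix (Equiv.prodAssoc (Fin d) (Fin d) (Fin m))
    rw [Matrix.submatrix_submatrix] at this
    simpa using this
  refine ⟨posSemidef_linkComp hRp hS.1, ?_⟩
  ext ⟨a, b⟩ ⟨a', b'⟩
  have h := fun m m' => congrFun (congrFun hR.2 (a, m)) (a', m')
  simp only [trLeft, Matrix.submatrix_apply, Equiv.prodAssoc_symm_apply, Matrix.one_apply,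
    Prod.mk.injEq] at h
  simp only [trLeft, regroup, Matrix.submatrix_apply, Equiv.prodAssoc_symm_apply, linkComp,
    Matrix.kroneckerMap_apply, Matrix.one_apply]
  rw [Finset.sum_comm]
  calc _ = ∑ k, ∑ k', (∑ c, R ((c, a), k) ((c, a'), k')) * S (k, b) (k', b') := by
        refine Finset.sum_congr rfl fun k _ => ?_
        rw [Finset.sum_comm]
        simp only [Finset.sum_mul]
    _ = _ := by
      simp only [h]
      by_cases ha : a = a' <;> simp [ha]

theorem isCompact_isLearningComb :
    IsCompact {L : Matrix ((Fin d × Fin d) × OIIdx N d) ((Fin d × Fin d) × OIIdx N d) ℂ |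
      IsLearningComb N d L} := by
  have h1 : IsCompact {Γ : Matrix (OIIdx N d) (OIIdx N d) ℂ | Γ.PosSemidef ∧ IsNormalized d N Γ} :=
    (isCompact_isNormalized N).inter_left isClosed_posSemidef
  have hk : Continuous fun Γ : Matrix (OIIdx N d) (OIIdx N d) ℂ =>
      (1 : Matrix (Fin d) (Fin d) ℂ) ⊗ₖ Γ :=
    continuous_matrix fun _ _ => continuous_const.mul (continuous_id.matrix_elem _ _)
  have ht : Continuous fun L : Matrix ((Fin d × Fin d) × OIIdx N d)
      ((Fin d × Fin d) × OIIdx N d) ℂ => trLeft (regroup L) :=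
    continuous_matrix fun _ _ => continuous_finsetSum _ fun _ _ => continuous_id.matrix_elem _ _
  convert isCompact_posSemidef_preimage ht (fun L => ?_) (h1.image hk) using 1
  · ext L
    refine and_congr_right fun _ => ⟨?_, ?_⟩
    · rintro ⟨Γ, h1, h2, h3⟩
      exact ⟨Γ, ⟨h1, h3⟩, h2.symm⟩
    · rintro ⟨Γ, ⟨h1, h3⟩, h2⟩
      exact ⟨Γ, h1, h2.symm, h3⟩
  · rw [trace_trLeft]
    exact (Equiv.prodAssoc (Fin d) (Fin d) (OIIdx N d)).symm.sum_comp fun p => L p p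

theorem exists_isLearningComb [NeZero d] :
    ∃ L : Matrix ((Fin d × Fin d) × OIIdx N d) ((Fin d × Fin d) × OIIdx N d) ℂ,
      IsLearningComb N d L := by
  obtain ⟨Γ, hΓ, hn⟩ := exists_isNormalized (d := d) N
  -- A retrieval whose output is always maximally mixed.
  refine ⟨(((d : ℂ)⁻¹ • 1) ⊗ₖ ((1 : Matrix (Fin d) (Fin d) ℂ) ⊗ₖ Γ)).submatrix
    (Equiv.prodAssoc _ _ _) (Equiv.prodAssoc _ _ _), ?_, Γ, hΓ, ?_, hn⟩
  · exact ((Matrix.PosSemidef.one.smul (by positivity)).kronecker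
      (Matrix.PosSemidef.one.kronecker hΓ)).submatrix _
  · have hd : (d : ℂ) ≠ 0 := NeZero.ne _
    rw [Matrix.submatrix_submatrix]
    simp [trLeft_kronecker, hd]

end learning

/-- An empty memory would give a zero marginal, against `IsNormalized.sum_diagonal`. -/
theorem IsNormalized.nonempty_of_trLeft {N d m : ℕ}
    {S : Matrix (Fin m × OIIdx N d) (Fin m × OIIdx N d) ℂ} (h : IsNormalized d N (trLeft S)) :
    Nonempty (Fin m) := by
  by_contra hm
  rw [not_nonempty_iff] at hm
  have := h.sum_diagonal
  simp [trLeft] at this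

/-! ### Parallel simulation and optimality -/

section optimality

variable {G : Type*} [Group G] [TopologicalSpace G] [IsTopologicalGroup G]
  [CompactSpace G] [MeasurableSpace G] [BorelSpace G] {N d : ℕ}
  {U : G → Matrix (Fin d) (Fin d) ℂ}

omit [IsTopologicalGroup G] [CompactSpace G] [MeasurableSpace G] [BorelSpace G] in
theorem exists_parallel_simulation [NeZero d] (hU : IsUnitaryRep U) {m : ℕ}
    {S : Matrix (Fin m × OIIdx N d) (Fin m × OIIdx N d) ℂ} (hS : IsStoringComb N d m S)
    (hc : ∀ g, Commute (trLeft S)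
      ((tpow N (U g)).map star ⊗ₖ (1 : Matrix (MIdx N d) (MIdx N d) ℂ))) :
    ∃ φ : OIIdx N d → ℂ, star φ ⬝ᵥ φ = 1 ∧
      (∃ D : Matrix (Fin m × OIIdx N d) (Fin m × OIIdx N d) ℂ, IsChannel D ∧
        ∀ g : G, link S (examples N (U g)) = link D (proj (parallelState N (U g) φ))) ∧
      ((∃ Ψ : Fin m × OIIdx N d → ℂ, S = proj Ψ) →
        ∃ E : Matrix (OIIdx N d × Fin m) (OIIdx N d × Fin m) ℂ, IsChannel E ∧
          ∀ g : G, proj (parallelState N (U g) φ) = link E (link S (examples N (U g)))) := by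
  obtain ⟨hS, hn⟩ := hS
  have := hn.nonempty_of_trLeft
  obtain ⟨R, Q, h, hR⟩ := exists_sqrtPair (posSemidef_trLeft hS)
  have hφ := sqrt_examples hU h fun g => hR _ (hc g)
  refine ⟨_, hn.unit_vector h, ?_, ?_⟩
  · obtain ⟨D, hD, hX⟩ := exists_channel_factor hS h
    refine ⟨D, hD, fun g => ?_⟩
    rw [← hφ, ← link_one_kronecker_conj, ← hX]
  · rintro ⟨Ψ, rfl⟩
    obtain ⟨A, rfl⟩ : ∃ A : Matrix (Fin m) (OIIdx N d) ℂ, dket A = Ψ :=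
      ⟨Matrix.of fun a b => Ψ (a, b), rfl⟩
    obtain ⟨E, hE, hlink⟩ := exists_polar_channel h
    refine ⟨E, hE, fun g => ?_⟩
    rw [← hφ, examples, ← hlink, ← link_proj_dket]

variable (μ : Measure G) [IsProbabilityMeasure μ] [μ.IsMulLeftInvariant]

/-- Every family of learning combs with the same storage can be replaced by parallel storage. -/
theorem exists_parallel_of_learning [NeZero d] (hU : IsUnitaryRep U)
    {Γ : Matrix (OIIdx N d) (OIIdx N d) ℂ} (hΓ : Γ.PosSemidef) (hn : IsNormalized d N Γ) :
    ∃ Γ' R Q : Matrix (OIIdx N d) (OIIdx N d) ℂ, SqrtPair Γ' R Q ∧ IsNormalized d N Γ' ∧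
      (∀ g, R.transpose * examples N (U g) * R.transpose =
        proj (parallelState N (U g) (R.transpose.mulVec (dket 1)))) ∧
      ∀ L : Matrix ((Fin d × Fin d) × OIIdx N d) ((Fin d × Fin d) × OIIdx N d) ℂ,
        L.PosSemidef → trLeft (regroup L) = (1 : Matrix (Fin d) (Fin d) ℂ) ⊗ₖ Γ →
        ∃ L' R', IsLearningComb N d L' ∧ IsRetrieving d R' ∧
          (∀ ρ, link L' ρ = link R' (R.transpose * ρ * R.transpose)) ∧
          avgFidelity μ U (fun g => link L' (examples N (U g))) =
            avgFidelity μ U (fun g => link L (examples N (U g))) := by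
  have hW := ((hU.tpow N).map_star).kronecker_one (κ := MIdx N d)
  have hΓ' := posSemidef_twirl (μ := μ) hW hΓ
  have hn' := isNormalized_twirl (μ := μ) hU hn
  -- The root is fixed by Γ alone, before any comb `L` is chosen.
  obtain ⟨R, Q, h, hR⟩ := exists_sqrtPair hΓ'
  refine ⟨_, R, Q, h, hn', sqrt_examples hU h fun g => hR _ (commute_twirl hW Γ g),
    fun L hL ht => ?_⟩
  have hL' := posSemidef_twirl (μ := μ) (hU.combAct (N := N)) hL
  have ht' := trLeft_regroup_twirl μ hU ht
  obtain ⟨R', hR', hlink⟩ := exists_retrieving_factor hL' h ht'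
  exact ⟨_, R', ⟨hL', _, hΓ', ht', hn'⟩, hR', hlink, avgFidelity_twirl μ hU L⟩

theorem exists_parallel_of_storing [NeZero d] (hU : IsUnitaryRep U) {m : ℕ}
    {S : Matrix (Fin m × OIIdx N d) (Fin m × OIIdx N d) ℂ} (hS : IsStoringComb N d m S) :
    ∃ φ : OIIdx N d → ℂ, star φ ⬝ᵥ φ = 1 ∧
      ∀ R : Matrix ((Fin d × Fin d) × Fin m) ((Fin d × Fin d) × Fin m) ℂ, IsRetrieving d R →
      ∃ R' : Matrix ((Fin d × Fin d) × OIIdx N d) ((Fin d × Fin d) × OIIdx N d) ℂ,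
        IsRetrieving d R' ∧
        avgFidelity μ U (fun g => link R' (proj (parallelState N (U g) φ))) =
          avgFidelity μ U (fun g => link R (link S (examples N (U g)))) := by
  obtain ⟨Γ', r, q, h, hn, hφ, H⟩ :=
    exists_parallel_of_learning μ hU (posSemidef_trLeft hS.1) hS.2
  refine ⟨_, hn.unit_vector h, fun R hR => ?_⟩
  obtain ⟨hpos, ht⟩ := isLearningComb_linkComp hS hR
  obtain ⟨L', R', -, hR', hlink, hF⟩ := H _ hpos ht
  refine ⟨R', hR', ?_⟩
  simp only [← hφ, ← hlink, link_link]
  exact hF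

theorem exists_optimal_parallel [NeZero d] (hU : IsUnitaryRep U) :
    ∃ φ : OIIdx N d → ℂ, star φ ⬝ᵥ φ = 1 ∧
      ∃ R' : Matrix ((Fin d × Fin d) × OIIdx N d) ((Fin d × Fin d) × OIIdx N d) ℂ,
        IsRetrieving d R' ∧
        IsGreatest
          {F : ℝ | ∃ (m : ℕ) (S : Matrix (Fin m × OIIdx N d) (Fin m × OIIdx N d) ℂ)
            (R : Matrix ((Fin d × Fin d) × Fin m) ((Fin d × Fin d) × Fin m) ℂ),
            IsStoringComb N d m S ∧ IsRetrieving d R ∧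
            F = avgFidelity μ U (fun g => link R (link S (examples N (U g))))}
          (avgFidelity μ U (fun g => link R' (proj (parallelState N (U g) φ)))) ∧
        IsGreatest
          {F : ℝ | ∃ L : Matrix ((Fin d × Fin d) × OIIdx N d) ((Fin d × Fin d) × OIIdx N d) ℂ,
            IsLearningComb N d L ∧ F = avgFidelity μ U (fun g => link L (examples N (U g)))}
          (avgFidelity μ U (fun g => link R' (proj (parallelState N (U g) φ)))) := by
  have hcont : Continuous fun
      L : Matrix ((Fin d × Fin d) × OIIdx N d) ((Fin d × Fin d) × OIIdx N d) ℂ =>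
      avgFidelity μ U (fun g => link L (examples N (U g))) := by
    simp only [avgFidelity_eq μ hU]
    exact (Complex.continuous_re.comp
      (LinearMap.continuous_of_finiteDimensional (fidFunctional N μ hU))).div_const _
  obtain ⟨L, hL, hmax⟩ := (isCompact_isLearningComb (N := N) (d := d)).exists_isMaxOn
    exists_isLearningComb hcont.continuousOn
  obtain ⟨hpos, Γ, hΓ, ht, hn⟩ := hL
  obtain ⟨Γ', r, q, h, hn', hφ, H⟩ := exists_parallel_of_learning μ hU hΓ hn
  obtain ⟨L', R', hL', hR', hlink, hF⟩ := H L hpos ht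
  have hval : avgFidelity μ U (fun g => link R' (proj (parallelState N (U g)
      (r.transpose.mulVec (dket 1))))) = avgFidelity μ U (fun g => link L' (examples N (U g))) := by
    simp only [← hφ, ← hlink]
  refine ⟨_, hn'.unit_vector h, R', hR', ⟨?_, ?_⟩, ⟨⟨L', hL', hval⟩, ?_⟩⟩
  -- The set ranges over boards with memory `Fin m`, so the parallel storage has to be realized as
  -- such a comb.
  · obtain ⟨m, S, T, hS, hT, hST⟩ := exists_parallel_board h hn' hR'
    refine ⟨m, S, T, hS, hT, ?_⟩
    simp only [hST, hφ]
  · rintro F ⟨m, S, T, hS, hT, rfl⟩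
    rw [hval, hF]
    simp only [link_link]
    obtain ⟨hp, ht⟩ := isLearningComb_linkComp hS hT
    exact hmax (show IsLearningComb N d (linkComp T S) from
      ⟨hp, trLeft S, posSemidef_trLeft hS.1, ht, hS.2⟩)
  · rintro F ⟨L₁, hL₁, rfl⟩
    rw [hval, hF]
    exact hmax hL₁

end optimality

theorem mainTheorem2 {G : Type*} [Group G] [TopologicalSpace G] [IsTopologicalGroup G]
    [CompactSpace G] [MeasurableSpace G] [BorelSpace G]
    (μ : Measure G) [μ.IsHaarMeasure] [IsProbabilityMeasure μ]
    (N d : ℕ) [NeZero d]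
    (u : G →* Matrix.unitaryGroup (Fin d) ℂ)
    (hu : Continuous fun g => (u g : Matrix (Fin d) (Fin d) ℂ)) :
    -- every covariant storing board is simulated by a parallel one, state by state;
    -- an isometric (rank one) covariant board is equivalent to the parallel one
    (∀ (m : ℕ) (S : Matrix (Fin m × OIIdx N d) (Fin m × OIIdx N d) ℂ),
      IsStoringComb N d m S →
      (∀ g h : G, Commute (trLeft S) ((tpow N (u g).1).map star ⊗ₖ tpow N (u h).1)) →
      ∃ φ : OIIdx N d → ℂ, star φ ⬝ᵥ φ = 1 ∧
        (∃ D : Matrix (Fin m × OIIdx N d) (Fin m × OIIdx N d) ℂ, IsChannel D ∧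
          ∀ g : G, link S (examples N (u g).1) = link D (proj (parallelState N (u g).1 φ))) ∧
        ((∃ Ψ : Fin m × OIIdx N d → ℂ, S = proj Ψ) →
          ∃ E : Matrix (OIIdx N d × Fin m) (OIIdx N d × Fin m) ℂ, IsChannel E ∧
            ∀ g : G, proj (parallelState N (u g).1 φ) = link E (link S (examples N (u g).1)))) ∧
    -- every storing board can be replaced by a parallel one, whatever the retrieving channel is,
    -- without changing the average fidelity
    (∀ (m : ℕ) (S : Matrix (Fin m × OIIdx N d) (Fin m × OIIdx N d) ℂ),
      IsStoringComb N d m S →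
      ∃ φ : OIIdx N d → ℂ, star φ ⬝ᵥ φ = 1 ∧
        ∀ R : Matrix ((Fin d × Fin d) × Fin m) ((Fin d × Fin d) × Fin m) ℂ, IsRetrieving d R →
        ∃ R' : Matrix ((Fin d × Fin d) × OIIdx N d) ((Fin d × Fin d) × OIIdx N d) ℂ,
          IsRetrieving d R' ∧
          avgFidelity μ (fun g => (u g).1)
              (fun g => link R' (proj (parallelState N (u g).1 φ))) =
            avgFidelity μ (fun g => (u g).1)
              (fun g => link R (link S (examples N (u g).1)))) ∧
    -- the optimal learning is achieved with parallel storage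
    (∃ φ : OIIdx N d → ℂ, star φ ⬝ᵥ φ = 1 ∧
      ∃ R' : Matrix ((Fin d × Fin d) × OIIdx N d) ((Fin d × Fin d) × OIIdx N d) ℂ,
        IsRetrieving d R' ∧
        IsGreatest
          {F : ℝ | ∃ (m : ℕ) (S : Matrix (Fin m × OIIdx N d) (Fin m × OIIdx N d) ℂ)
            (R : Matrix ((Fin d × Fin d) × Fin m) ((Fin d × Fin d) × Fin m) ℂ),
            IsStoringComb N d m S ∧ IsRetrieving d R ∧
            F = avgFidelity μ (fun g => (u g).1)
              (fun g => link R (link S (examples N (u g).1)))}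
          (avgFidelity μ (fun g => (u g).1)
            (fun g => link R' (proj (parallelState N (u g).1 φ)))) ∧
        IsGreatest
          {F : ℝ | ∃ L : Matrix ((Fin d × Fin d) × OIIdx N d) ((Fin d × Fin d) × OIIdx N d) ℂ,
            IsLearningComb N d L ∧
            F = avgFidelity μ (fun g => (u g).1) (fun g => link L (examples N (u g).1))}
          (avgFidelity μ (fun g => (u g).1)
            (fun g => link R' (proj (parallelState N (u g).1 φ))))) := by
  have hU : IsUnitaryRep fun g => (u g : Matrix (Fin d) (Fin d) ℂ) :=
    ⟨hu, fun g => Matrix.mem_unitaryGroup_iff'.1 (u g).2, fun g h => by simp⟩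
  refine ⟨fun m S hS hc => ?_, fun m S hS => exists_parallel_of_storing μ hU hS,
    exists_optimal_parallel μ hU⟩
  refine exists_parallel_simulation hU hS fun g => ?_
  have := hc g 1
  rwa [map_one, show ((1 : Matrix.unitaryGroup (Fin d) ℂ).1) = 1 from rfl, tpow_one] at this
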